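/- Let $\lambda$ denote an uncountable cardinal. For a set $C$ of ordinals, $\mathrm{otp}(C)$ is its order type, $C(i)$ is its $i$-th element, that is, the unique $\beta\in C$ with $\mathrm{otp}(C\cap\beta)=i$ (for $i<\mathrm{otp}(C)$), and $\mathrm{acc}(C)$ is the set of nonzero $\beta\in C$ with $\sup(C\cap\beta)=\beta$. Limit ordinals are understood to be nonzero. A $\square_\lambda$-sequence is a sequence $\langle C_\alpha\mid\alpha<\lambda^+\rangle$ of sets of ordinals such that for every limit $\alpha<\lambda^+$: (1) $C_\alpha$ is a closed unbounded subset of $\alpha$ of order type at most $\lambda$; (2) if $\beta\in\mathrm{acc}(C_\alpha)$, then $C_\beta=C_\alpha\cap\beta$. The principle $\square_\lambda$ asserts that a $\square_\lambda$-sequence exists. The Ostaszewski square $\clubsuit\!\!\!\!\square_\lambda$ asserts the existence of a $\square_\lambda$-sequence $\langle C_\alpha\mid\alpha<\lambda^+\rangle$ such that for every sequence $\langle A_i\mid i<\lambda\rangle$ of unbounded subsets of $\lambda^+$, every limit $\theta<\lambda$ and every club $D\subseteq\lambda^+$, there is a limit ordinal $\alpha<\lambda^+$ such that $\mathrm{otp}(C_\alpha)=\theta$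 and for all $i<\theta$: (a) $C_\alpha(i+1)\in A_i$; (b) $C_\alpha(i)<\beta<C_\alpha(i+1)$ for some $\beta\in D$. **Theorem B.** $\square_\lambda$ implies $\clubsuit\!\!\!\!\square_\lambda$ in each of the following two cases: * $\lambda$ is an uncountable limit cardinal and $\lambda^\lambda=\lambda^+$; * $\lambda$ is an uncountable successor cardinal and $\lambda^{<\lambda}<\lambda^\lambda=\lambda^+$. In particular, under GCH ($2^\mu=\mu^+$ for every infinite cardinal $\mu$), $\square_\lambda$ and $\clubsuit\!\!\!\!\square_\lambda$ are equivalent for every uncountable cardinal $\lambda$. -/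

import Mathlib

open Set Order Cardinal Ordinal

universe u

namespace OstaszewskiSquare

/-- The order type of a set of ordinals (it lives one universe up, since a set of ordinals may be a
proper class as far as the universe `u` is concerned). -/
noncomputable def otp (C : Set Ordinal.{u}) : Ordinal.{u + 1} :=
  typeLT C

/-- `nth C i` is the `i`-th element `C(i)` of `C`: the unique `β ∈ C` such that the order type of
`C ∩ β` is `i`. It is meaningful for `i < otp C` only. -/
noncomputable def nth (C : Set Ordinal.{u}) (i : Ordinal.{u}) : Ordinal.{u} :=
  sInf {β | β ∈ C ∧ otp (C ∩ Iio β) = Ordinal.lift.{u + 1} i}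

/-- The accumulation points of `C` that belong to `C`: the nonzero `β ∈ C` with
`sup (C ∩ β) = β`. -/
def acc (C : Set Ordinal.{u}) : Set Ordinal.{u} :=
  {β | β ∈ C ∧ β ≠ 0 ∧ IsLUB (C ∩ Iio β) β}

/-- `C` is a closed and unbounded subset of the ordinal `δ = {γ | γ < δ}`. -/
def IsClubIn (C : Set Ordinal.{u}) (δ : Ordinal.{u}) : Prop :=
  C ⊆ Iio δ ∧ IsClub ((fun γ : Iio δ => (γ : Ordinal.{u})) ⁻¹' C)

/-- `A` is an unbounded (cofinal) subset of the ordinal `δ`. -/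
def IsUnboundedIn (A : Set Ordinal.{u}) (δ : Ordinal.{u}) : Prop :=
  A ⊆ Iio δ ∧ IsCofinal ((fun γ : Iio δ => (γ : Ordinal.{u})) ⁻¹' A)

/-- `⟨C α | α < κ⁺⟩` is a `□_κ`-sequence. Only the values of `C` at limit ordinals `α < κ⁺`
matter. (Limit ordinals are nonzero.) -/
def IsSquareSeq (κ : Cardinal.{u}) (C : Ordinal.{u} → Set Ordinal.{u}) : Prop :=
  ∀ α < (succ κ).ord, IsSuccLimit α →
    IsClubIn (C α) α ∧ otp (C α) ≤ Ordinal.lift.{u + 1} κ.ord ∧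
      ∀ β ∈ acc (C α), C β = C α ∩ Iio β

/-- Jensen's principle `□_κ`. -/
def Square (κ : Cardinal.{u}) : Prop :=
  ∃ C : Ordinal.{u} → Set Ordinal.{u}, IsSquareSeq κ C

/-- The guessing property: for all unbounded `A i ⊆ κ⁺` (`i < κ`), all limit `θ < κ` and all clubs
`D ⊆ κ⁺` there is a limit `α < κ⁺` such that `C α` has order type `θ`, and, for all `i < θ`,
the element of `C α` with index `i + 1` is in `A i`, and an element of `D` lies strictly
between the elements of `C α` with indices `i` and `i + 1`. -/
def Guesses (κ : Cardinal.{u}) (C : Ordinal.{u} → Set Ordinal.{u}) : Prop :=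
  ∀ A : Ordinal.{u} → Set Ordinal.{u}, (∀ i < κ.ord, IsUnboundedIn (A i) (succ κ).ord) →
    ∀ θ < κ.ord, IsSuccLimit θ →
      ∀ D : Set Ordinal.{u}, IsClubIn D (succ κ).ord →
        ∃ α < (succ κ).ord, IsSuccLimit α ∧ otp (C α) = Ordinal.lift.{u + 1} θ ∧
          ∀ i < θ, nth (C α) (i + 1) ∈ A i ∧
            ∃ β ∈ D, nth (C α) i < β ∧ β < nth (C α) (i + 1)

/-- The Ostaszewski square at `κ`. -/
def Ostaszewski (κ : Cardinal.{u}) : Prop :=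
  ∃ C : Ordinal.{u} → Set Ordinal.{u}, IsSquareSeq κ C ∧ Guesses κ C

end OstaszewskiSquare

namespace OstaszewskiSquare

/-! ### Limit points and clubs -/

/-! Fix a square sequence `x`. A club can be thinned out along a relation which says when a point
may be the next one kept. If that relation is monotone and looks only at an initial part of the club
(`IsStepRel`), the adjusted clubs form a square sequence again (`isClubIn_adjust`, `acc_adjust`). It
remains to find relations whose adjusted clubs guess. By `exists_guess` it is enough to guess
functions `g`: the element with index `i + 1` should be `g δ i` for some `δ` at or above the element
with index `i`.

Suppose that every relation fails. Since `κ ^ κ = κ⁺`, the values at one point of a whole family of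
functions are coded by one ordinal below `κ⁺` (`exists_codes`). For each `τ < κ` a sequence of
relations is built by recursion. The `q`-th one proposes the `q`-th value of a code that is right,
at some point `δ`, about all earlier counterexamples; its failure supplies the `q`-th
counterexample. The codes are taken from a set of size less than `κ` that is computed from an
initial part of the club (`smallSet`). By pigeonhole, `κ` many relations fail at the same `θ`. In
the club of a suitable `α` all of them make `θ` steps below one common point (`exists_bound_thin`).
Each failure leaves a triple `(i, δ, η)` where the code `η` is right before `q` and wrong at `q`.
The triple determines `q`, and there are fewer than `κ` triples, a contradiction (`mk_misses_lt`).

The suitable points are those of `IsGood`. For regular `κ` take `α` of cofinality `κ`: its club has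
order type `κ`, so its small sets eventually contain any given code. For singular `κ` take points
whose clubs have a fixed order type of cofinality above that of `κ`: then one `τ` is right cofinally
often. Such points serve only `θ` below that cofinality, so many order types are needed, each with
its own relation. They are kept apart by labels that do not change along the coherent sequence,
obtained by cutting the clubs (`acc_cut`, `exists_blocks`, `ostaszewski_of_labels`). -/

/-- `β` is a nonzero limit of elements of `x`. -/
def IsLimitPt (x : Set Ordinal.{u}) (β : Ordinal.{u}) : Prop :=
  β ≠ 0 ∧ ∀ b < β, ∃ c ∈ x, b < c ∧ c < β

theorem IsLimitPt.isSuccLimit {x : Set Ordinal.{u}} {β : Ordinal.{u}} (h : IsLimitPt x β) :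
    IsSuccLimit β := by
  refine Ordinal.isSuccLimit_iff.2 ⟨h.1, ?_⟩
  rw [isSuccPrelimit_iff_succ_lt]
  intro b hb
  obtain ⟨c, -, h1, h2⟩ := h.2 b hb
  exact (succ_le_of_lt h1).trans_lt h2

theorem IsLimitPt.mono {x y : Set Ordinal.{u}} {β : Ordinal.{u}} (h : IsLimitPt x β)
    (hxy : x ⊆ y) : IsLimitPt y β :=
  ⟨h.1, fun b hb => let ⟨c, h1, h2⟩ := h.2 b hb; ⟨c, hxy h1, h2⟩⟩

theorem mem_acc_iff {x : Set Ordinal.{u}} {β : Ordinal.{u}} :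
    β ∈ acc x ↔ β ∈ x ∧ IsLimitPt x β := by
  refine and_congr_right fun _ => and_congr_right fun h0 => ⟨fun h b hb => ?_, fun h => ?_⟩
  · obtain ⟨c, hc, h1, -⟩ := h.exists_between hb
    exact ⟨c, hc.1, h1, hc.2⟩
  · refine ⟨fun c hc => hc.2.le, fun c hc => ?_⟩
    by_contra hlt
    obtain ⟨d, h1, h2, h3⟩ := h c (not_le.1 hlt)
    exact absurd (hc ⟨h1, h3⟩) (not_le.2 h2)

theorem isClubIn_iff {x : Set Ordinal.{u}} {α : Ordinal.{u}} (hα : IsSuccLimit α) :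
    IsClubIn x α ↔ x ⊆ Iio α ∧ (∀ b < α, ∃ c ∈ x, b < c) ∧
      ∀ γ < α, IsLimitPt x γ → γ ∈ x := by
  refine and_congr_right fun hx => ?_
  rw [isClub_iff]
  constructor
  · rintro ⟨h1, h2⟩
    refine ⟨fun b hb => ?_, fun γ hγ hl => ?_⟩
    · obtain ⟨c, hc, hbc⟩ := h2 ⟨succ b, hα.succ_lt hb⟩
      exact ⟨c, hc, succ_le_iff.1 hbc⟩
    · have := @h1 {c : Iio α | (c : Ordinal) ∈ x ∧ (c : Ordinal) < γ} (fun c hc => hc.1) ?_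
        (.of_linearOrder _) ⟨γ, hγ⟩ ⟨fun c hc => hc.2.le, fun c hc => ?_⟩
      · exact this
      · obtain ⟨c, hc, -, h3⟩ := hl.2 0 (pos_iff_ne_zero.2 hl.1)
        exact ⟨⟨c, h3.trans hγ⟩, hc, h3⟩
      · by_contra hlt
        obtain ⟨d, h1, h2, h3⟩ := hl.2 c (not_le.1 hlt)
        exact absurd (hc (a := ⟨d, h3.trans hγ⟩) ⟨h1, h3⟩) (not_le.2 h2)
  · rintro ⟨h1, h2⟩
    refine ⟨fun d hd hne _ a ha => ?_, fun b => ?_⟩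
    · by_cases had : a ∈ d
      · exact hd had
      refine h2 a a.2 ⟨?_, fun b hb => ?_⟩
      · obtain ⟨c, hc⟩ := hne
        have : c < a := lt_of_le_of_ne (ha.1 hc) (fun h => had (h ▸ hc))
        exact (bot_le.trans_lt (Subtype.coe_lt_coe.2 this)).ne'
      · obtain ⟨c, hc, h3, -⟩ := ha.exists_between (b := ⟨b, hb.trans a.2⟩) (Subtype.coe_lt_coe.1 hb)
        have : c < a := lt_of_le_of_ne (ha.1 hc) (fun h => had (h ▸ hc))
        exact ⟨c, hd hc, Subtype.coe_lt_coe.2 h3, Subtype.coe_lt_coe.2 this⟩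
    · obtain ⟨c, hc, hbc⟩ := h1 b b.2
      exact ⟨⟨c, hx hc⟩, hc, Subtype.coe_le_coe.1 hbc.le⟩

theorem IsUnboundedIn.exists_gt {x : Set Ordinal.{u}} {α : Ordinal.{u}} (h : IsUnboundedIn x α)
    (hα : IsSuccLimit α) {b : Ordinal.{u}} (hb : b < α) : ∃ c ∈ x, b < c := by
  obtain ⟨c, hc, hbc⟩ := h.2 ⟨succ b, hα.succ_lt hb⟩
  exact ⟨c, hc, succ_le_iff.1 hbc⟩

/-! ### Order types -/

theorem otp_mono {x y : Set Ordinal.{u}} (h : x ⊆ y) : otp x ≤ otp y :=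
  type_mono h

theorem otp_Iio (α : Ordinal.{u}) : otp (Iio α) = Ordinal.lift.{u + 1} α :=
  type_lt_Iio α

theorem otp_le_of_strictMonoOn {x y : Set Ordinal.{u}} (f : Ordinal.{u} → Ordinal.{u})
    (hf : StrictMonoOn f x) (hxy : ∀ a ∈ x, f a ∈ y) : otp x ≤ otp y := by
  rw [otp, otp, type_le_iff']
  exact ⟨(OrderEmbedding.ofStrictMono (fun a : x => (⟨f a, hxy a a.2⟩ : y))
    fun a b hab => hf a.2 b.2 hab).ltEmbedding⟩

theorem otp_image {x : Set Ordinal.{u}} {f : Ordinal.{u} → Ordinal.{u}} (hf : StrictMonoOn f x) :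
    otp (f '' x) = otp x := by
  refine le_antisymm ?_ (otp_le_of_strictMonoOn f hf fun a ha => mem_image_of_mem f ha)
  refine otp_le_of_strictMonoOn (Function.invFunOn f x) ?_ ?_
  · rintro _ ⟨a, ha, rfl⟩ _ ⟨b, hb, rfl⟩ hab
    rw [hf.injOn.leftInvOn_invFunOn ha, hf.injOn.leftInvOn_invFunOn hb]
    exact (hf.lt_iff_lt ha hb).1 hab
  · rintro _ ⟨a, ha, rfl⟩
    rwa [hf.injOn.leftInvOn_invFunOn ha]

theorem card_otp (x : Set Ordinal.{u}) : (otp x).card = #x := rfl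

theorem otp_inter_eq_typein {x : Set Ordinal.{u}} {γ : Ordinal.{u}} (hγ : γ ∈ x) :
    otp (x ∩ Iio γ) = typein (α := x) (· < ·) ⟨γ, hγ⟩ := by
  rw [← type_Iio_lt]
  refine RelIso.ordinalType_congr (OrderIso.toRelIsoLT (α := ↥(x ∩ Iio γ))
    (β := Iio (⟨γ, hγ⟩ : x)) ⟨⟨fun a => ⟨⟨a, a.2.1⟩, a.2.2⟩, fun a => ⟨a, a.1.2, a.2⟩,
      fun _ => rfl, fun _ => rfl⟩, Iff.rfl⟩)

theorem otp_inter_lt {x : Set Ordinal.{u}} {γ : Ordinal.{u}} (hγ : γ ∈ x) :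
    otp (x ∩ Iio γ) < otp x := by
  rw [otp_inter_eq_typein hγ]
  exact typein_lt_type _ _

theorem exists_otp_inter_eq {x : Set Ordinal.{u}} {o : Ordinal.{u + 1}} (ho : o < otp x) :
    ∃ γ ∈ x, otp (x ∩ Iio γ) = o := by
  obtain ⟨γ, hγ⟩ := typein_surj (α := x) (· < ·) ho
  exact ⟨γ, γ.2, by rw [otp_inter_eq_typein γ.2, ← hγ]⟩

theorem otp_inter_lt_otp_inter {x : Set Ordinal.{u}} {γ δ : Ordinal.{u}} (hγ : γ ∈ x)
    (h : γ < δ) : otp (x ∩ Iio γ) < otp (x ∩ Iio δ) := by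
  have := otp_inter_lt (x := x ∩ Iio δ) (γ := γ) ⟨hγ, h⟩
  rwa [inter_assoc, Iio_inter_Iio, min_eq_right h.le] at this

theorem lt_of_otp_inter_lt {x : Set Ordinal.{u}} {γ δ : Ordinal.{u}}
    (h : otp (x ∩ Iio γ) < otp (x ∩ Iio δ)) : γ < δ := by
  by_contra hlt
  exact absurd (otp_mono (inter_subset_inter_right x (Iio_subset_Iio (not_lt.1 hlt))))
    (not_le.2 h)

/-- The order type of an initial part of `x` is continuous at limit points of `x`. -/
theorem exists_lt_otp_inter {x : Set Ordinal.{u}} {γ : Ordinal.{u}} {o : Ordinal.{u + 1}}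
    (ho : o < otp (x ∩ Iio γ)) : ∃ δ ∈ x, δ < γ ∧ o = otp (x ∩ Iio δ) := by
  obtain ⟨δ, hδ, h⟩ := exists_otp_inter_eq ho
  refine ⟨δ, hδ.1, hδ.2, ?_⟩
  rw [← h, inter_assoc, Iio_inter_Iio, min_eq_right (le_of_lt hδ.2)]

/-- The part of the image below `f j` is the image of `j`, so its order type identifies `j`. -/
theorem nth_image {f : Ordinal.{u} → Ordinal.{u}} {θ : Ordinal.{u}}
    (hf : StrictMonoOn f (Iio θ)) {i : Ordinal.{u}} (hi : i < θ) : nth (f '' Iio θ) i = f i := by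
  have key : ∀ j < θ, otp (f '' Iio θ ∩ Iio (f j)) = Ordinal.lift.{u + 1} j := by
    intro j hj
    have : f '' Iio θ ∩ Iio (f j) = f '' Iio j := by
      ext a
      constructor
      · rintro ⟨⟨k, hk, rfl⟩, h⟩
        exact ⟨k, (hf.lt_iff_lt hk hj).1 h, rfl⟩
      · rintro ⟨k, hk, rfl⟩
        have hk' : k < j := hk
        exact ⟨⟨k, hk'.trans hj, rfl⟩, hf (hk'.trans hj) hj hk⟩
    rw [this, otp_image (hf.mono (Iio_subset_Iio hj.le)), otp_Iio]
  have : {β | β ∈ f '' Iio θ ∧ otp (f '' Iio θ ∩ Iio β) = Ordinal.lift.{u + 1} i} = {f i} := by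
    ext β
    constructor
    · rintro ⟨⟨k, hk, rfl⟩, h⟩
      rw [key k hk, Ordinal.lift_inj] at h
      rw [h]; rfl
    · rintro rfl
      exact ⟨mem_image_of_mem f hi, key i hi⟩
  rw [nth, this, csInf_singleton]

/-! ### Thinning out a club along a local step relation -/

/-- `R x i d g ξ` is meant to say that, when the club `x` is thinned out and the `i`-th element
of `x` that is kept is `d`, then the next element that is kept may be `g`, and `ξ` is a point
between `d` and `g`. Whether this is the case is required to be monotone in `g` and to depend
on the part of `x` up to `g` only. -/
structure IsStepRel
    (R : Set Ordinal.{u} → Ordinal.{u} → Ordinal.{u} → Ordinal.{u} → Ordinal.{u} → Prop) :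
    Prop where
  lt_left : ∀ {x i d g ξ}, R x i d g ξ → d < ξ
  lt_right : ∀ {x i d g ξ}, R x i d g ξ → ξ < g
  mono : ∀ {x i d g g' ξ}, g ≤ g' → R x i d g ξ → R x i d g' ξ
  inter_iff : ∀ {x i d g ξ β}, g < β → (R (x ∩ Iio β) i d g ξ ↔ R x i d g ξ)

section thinning

variable (R : Set Ordinal.{u} → Ordinal.{u} → Ordinal.{u} → Ordinal.{u} → Ordinal.{u} → Prop)
  (x : Set Ordinal.{u})

/-- The `i`-th element that is kept when `x` is thinned out along `R`. -/
noncomputable def thin (i : Ordinal.{u}) : Ordinal.{u} :=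
  sInf {g | g ∈ x ∧ ∀ j, (_ : j < i) → ∃ ξ, R x j (thin j) g ξ}
termination_by i

/-- The candidates for `thin R x i`. -/
def thinSet (i : Ordinal.{u}) : Set Ordinal.{u} :=
  {g | g ∈ x ∧ ∀ j < i, ∃ ξ, R x j (thin R x j) g ξ}

/-- The number of steps after which thinning out `x` along `R` comes to an end. -/
noncomputable def thinLen : Ordinal.{u} :=
  sInf {i | thinSet R x i = ∅}

/-- The least point which `R` provides between `thin R x i` and `thin R x (succ i)`. -/
noncomputable def midPt (i : Ordinal.{u}) : Ordinal.{u} :=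
  sInf {ξ | R x i (thin R x i) (thin R x (succ i)) ξ}

open Classical in
/-- The elements of the adjusted club: at successors those of the thinned out club are replaced by
the points which `R` provides. -/
noncomputable def adjPt (i : Ordinal.{u}) : Ordinal.{u} :=
  if h : ∃ j, i = succ j then midPt R x h.choose else thin R x i

open Classical in
/-- The adjusted club. If thinning out `x` gets stuck, then this is a final part of `x`. -/
noncomputable def adjust : Set Ordinal.{u} :=
  if IsSuccLimit (thinLen R x) then adjPt R x '' Iio (thinLen R x)
  else {g | g ∈ x ∧ ∀ j < thinLen R x, thin R x j ≤ g}

variable {R x} {α β γ i j : Ordinal.{u}}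

theorem thin_eq_sInf (i : Ordinal.{u}) : thin R x i = sInf (thinSet R x i) := by
  rw [thin]; rfl

theorem thinSet_anti (h : i ≤ j) : thinSet R x j ⊆ thinSet R x i :=
  fun _ hg => ⟨hg.1, fun k hk => hg.2 k (hk.trans_le h)⟩

theorem thin_mem (h : (thinSet R x i).Nonempty) : thin R x i ∈ thinSet R x i := by
  rw [thin_eq_sInf]; exact csInf_mem h

theorem thin_le (h : γ ∈ thinSet R x i) : thin R x i ≤ γ := by
  rw [thin_eq_sInf]; exact csInf_le' h

theorem adjPt_succ (i : Ordinal.{u}) : adjPt R x (succ i) = midPt R x i := by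
  have h : ∃ j, succ i = succ j := ⟨i, rfl⟩
  rw [adjPt, dif_pos h, ← succ_injective h.choose_spec]

theorem adjPt_of_isSuccPrelimit (h : IsSuccPrelimit i) : adjPt R x i = thin R x i := by
  rw [adjPt, dif_neg]
  rintro ⟨j, rfl⟩
  exact not_isSuccPrelimit_succ j h

/-! ### Thinned out and adjusted clubs are clubs. -/

namespace IsStepRel

variable (hR : IsStepRel R)
include hR

theorem lt_of_mem_thinSet (h : γ ∈ thinSet R x i) (hj : j < i) : thin R x j < γ := by
  obtain ⟨ξ, hξ⟩ := h.2 j hj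
  exact (hR.lt_left hξ).trans (hR.lt_right hξ)

/-- The kept points increase strictly. This forces thinning inside `α` to stop by stage `α`. -/
theorem le_thin (h : (thinSet R x i).Nonempty) : i ≤ thin R x i := by
  induction i using WellFoundedLT.induction with
  | ind i ih =>
    refine le_of_forall_lt fun j hj => ?_
    exact (ih j hj (h.mono (thinSet_anti hj.le))).trans_lt (hR.lt_of_mem_thinSet (thin_mem h) hj)

theorem thinSet_eq_empty (hx : x ⊆ Iio α) : thinSet R x α = ∅ := by
  by_contra h
  have h' := nonempty_iff_ne_empty.2 h
  exact absurd (hR.le_thin h') (not_le.2 (hx (thin_mem h').1))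

theorem thinSet_thinLen (hx : x ⊆ Iio α) : thinSet R x (thinLen R x) = ∅ :=
  csInf_mem (s := {i | thinSet R x i = ∅}) ⟨α, hR.thinSet_eq_empty hx⟩

theorem lt_thinLen_iff (hx : x ⊆ Iio α) : i < thinLen R x ↔ (thinSet R x i).Nonempty := by
  constructor
  · intro h
    exact nonempty_iff_ne_empty.2 fun h' =>
      notMem_of_lt_csInf (s := {i | thinSet R x i = ∅}) h (OrderBot.bddBelow _) h'
  · intro h
    by_contra hlt
    exact absurd (h.mono (thinSet_anti (not_lt.1 hlt)))
      (by rw [hR.thinSet_thinLen hx]; exact not_nonempty_empty)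

theorem thin_mem_of_lt (hx : x ⊆ Iio α) (h : i < thinLen R x) : thin R x i ∈ thinSet R x i :=
  thin_mem ((hR.lt_thinLen_iff hx).1 h)

theorem thin_lt_thin (hx : x ⊆ Iio α) (h : i < thinLen R x) (hj : j < i) :
    thin R x j < thin R x i :=
  hR.lt_of_mem_thinSet (hR.thin_mem_of_lt hx h) hj

theorem strictMonoOn_thin (hx : x ⊆ Iio α) : StrictMonoOn (thin R x) (Iio (thinLen R x)) :=
  fun _ _ _ hj hij => hR.thin_lt_thin hx hj hij

/-- Thinning is continuous: the least strict upper bound `s` of the earlier kept points is a limit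
of `x`, and by monotonicity the step from `j` to `j + 1` is also a permitted step from `j` to `s`.
-/
theorem exists_mem_thinSet_le (hα : IsSuccLimit α) (hx : IsClubIn x α) (hi : IsSuccLimit i)
    (hlen : i ≤ thinLen R x) (hγ : γ < α) (h : ∀ j < i, thin R x j ≤ γ) :
    ∃ s ∈ thinSet R x i, s ≤ γ := by
  obtain ⟨hxα, -, hcl⟩ := (isClubIn_iff hα).1 hx
  have hlt : ∀ j < i, thin R x j < thin R x (succ j) := fun j hj =>
    hR.thin_lt_thin hxα ((hi.succ_lt hj).trans_le hlen) (lt_succ j)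
  have hγ' : γ ∈ {s | ∀ j < i, thin R x j < s} := fun j hj =>
    (hlt j hj).trans_le (h _ (hi.succ_lt hj))
  set s := sInf {s | ∀ j < i, thin R x j < s} with hs
  have hsle : s ≤ γ := csInf_le' hγ'
  have hsub : ∀ j < i, thin R x j < s := csInf_mem (s := {s | ∀ j < i, thin R x j < s}) ⟨γ, hγ'⟩
  have hlim : IsLimitPt x s := by
    refine ⟨(bot_le.trans_lt (hsub 0 hi.bot_lt)).ne', fun b hb => ?_⟩
    have hb' := notMem_of_lt_csInf hb (OrderBot.bddBelow _)
    simp only [mem_ofPred_eq, not_forall, not_lt] at hb'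
    obtain ⟨j, hj, hbj⟩ := hb'
    exact ⟨thin R x (succ j), (hR.thin_mem_of_lt hxα ((hi.succ_lt hj).trans_le hlen)).1,
      hbj.trans_lt (hlt j hj), hsub _ (hi.succ_lt hj)⟩
  refine ⟨s, ⟨hcl s (hsle.trans_lt hγ) hlim, fun j hj => ?_⟩, hsle⟩
  obtain ⟨ξ, hξ⟩ := (hR.thin_mem_of_lt hxα ((hi.succ_lt hj).trans_le hlen)).2 j (lt_succ j)
  exact ⟨ξ, hR.mono (hsub _ (hi.succ_lt hj)).le hξ⟩

theorem exists_lt_thin (hα : IsSuccLimit α) (hx : IsClubIn x α) (hi : IsSuccLimit i)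
    (hlen : i < thinLen R x) (hγ : γ < thin R x i) : ∃ j < i, γ < thin R x j := by
  by_contra! h
  have hi' := hR.thin_mem_of_lt hx.1 hlen
  obtain ⟨s, hs, hsγ⟩ := hR.exists_mem_thinSet_le hα hx hi hlen.le (hγ.trans (hx.1 hi'.1)) h
  exact absurd ((thin_le hs).trans hsγ) (not_le.2 hγ)

theorem exists_lt_thin' (hα : IsSuccLimit α) (hx : IsClubIn x α) (hi : IsSuccLimit (thinLen R x))
    (hγ : γ < α) : ∃ j < thinLen R x, γ < thin R x j := by
  by_contra! h
  obtain ⟨s, hs, -⟩ := hR.exists_mem_thinSet_le hα hx hi le_rfl hγ h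
  rw [hR.thinSet_thinLen hx.1] at hs
  exact hs

theorem midPt_spec (hx : x ⊆ Iio α) (h : succ i < thinLen R x) :
    R x i (thin R x i) (thin R x (succ i)) (midPt R x i) :=
  csInf_mem (s := {ξ | R x i (thin R x i) (thin R x (succ i)) ξ})
    ((hR.thin_mem_of_lt hx h).2 i (lt_succ i))

theorem adjPt_le (hx : x ⊆ Iio α) (h : i < thinLen R x) : adjPt R x i ≤ thin R x i := by
  by_cases hi : IsSuccPrelimit i
  · rw [adjPt_of_isSuccPrelimit hi]
  · obtain ⟨j, rfl⟩ := not_isSuccPrelimit_iff_mem_range_succ.1 hi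
    rw [adjPt_succ]
    exact (hR.lt_right (hR.midPt_spec hx h)).le

/-- Together with `adjPt_le`: kept and adjusted points interleave, and they agree at limit indices.
-/
theorem lt_adjPt (hx : x ⊆ Iio α) (h : i < thinLen R x) (hj : j < i) :
    thin R x j < adjPt R x i := by
  by_cases hi : IsSuccPrelimit i
  · rw [adjPt_of_isSuccPrelimit hi]
    exact hR.thin_lt_thin hx h hj
  · obtain ⟨k, rfl⟩ := not_isSuccPrelimit_iff_mem_range_succ.1 hi
    rw [adjPt_succ]
    have hk := (lt_succ k).trans h
    exact ((hR.strictMonoOn_thin hx).monotoneOn ((lt_succ_iff.1 hj).trans_lt hk) hk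
      (lt_succ_iff.1 hj)).trans_lt (hR.lt_left (hR.midPt_spec hx h))

theorem strictMonoOn_adjPt (hx : x ⊆ Iio α) : StrictMonoOn (adjPt R x) (Iio (thinLen R x)) :=
  fun _ hi _ hj hij => (hR.adjPt_le hx hi).trans_lt (hR.lt_adjPt hx hj hij)

theorem isSuccLimit_of_isLimitPt (hx : x ⊆ Iio α) (hi : i < thinLen R x)
    (hγ : IsLimitPt (adjPt R x '' Iio (thinLen R x)) γ) (hle : γ ≤ adjPt R x i)
    (hlt : ∀ j < i, adjPt R x j < γ) : IsSuccLimit i := by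
  have hmono := hR.strictMonoOn_adjPt hx
  have key : ∀ b < γ, ∃ j < i, b < adjPt R x j := by
    intro b hb
    obtain ⟨_, ⟨j, hj, rfl⟩, h1, h2⟩ := hγ.2 b hb
    exact ⟨j, (hmono.lt_iff_lt hj hi).1 (h2.trans_le hle), h1⟩
  refine Ordinal.isSuccLimit_iff.2 ⟨?_, isSuccPrelimit_iff_succ_lt.2 fun k hk => ?_⟩
  · rintro rfl
    obtain ⟨j, hj, -⟩ := key 0 (pos_iff_ne_zero.2 hγ.1)
    exact not_lt_bot hj
  · obtain ⟨j, hj, h⟩ := key _ (hlt k hk)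
    exact (succ_le_of_lt ((hmono.lt_iff_lt (hk.trans hi) (hj.trans hi)).1 h)).trans_lt hj

theorem thinLen_pos (hα : IsSuccLimit α) (hx : IsClubIn x α) : 0 < thinLen R x := by
  obtain ⟨hxα, hub, -⟩ := (isClubIn_iff hα).1 hx
  obtain ⟨c, hc, -⟩ := hub 0 hα.bot_lt
  exact (hR.lt_thinLen_iff hxα).2 ⟨c, hc, fun j hj => absurd hj not_lt_bot⟩

theorem exists_thinLen_eq_succ (hα : IsSuccLimit α) (hx : IsClubIn x α)
    (h : ¬ IsSuccLimit (thinLen R x)) : ∃ k, thinLen R x = succ k := by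
  have h' : ¬ IsSuccPrelimit (thinLen R x) := fun h' =>
    h (Ordinal.isSuccLimit_iff.2 ⟨(hR.thinLen_pos hα hx).ne', h'⟩)
  obtain ⟨k, hk⟩ := not_isSuccPrelimit_iff_mem_range_succ.1 h'
  exact ⟨k, hk.symm⟩

/-- If thinning has limit length, the kept points are cofinal in `α`, and interleaving transfers
cofinality and closure to the adjusted points. Otherwise the set is a tail of `x`, starting at the
last kept point. -/
theorem isClubIn_adjust (hα : IsSuccLimit α) (hx : IsClubIn x α) : IsClubIn (adjust R x) α := by
  obtain ⟨hxα, hub, hcl⟩ := (isClubIn_iff hα).1 hx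
  rw [isClubIn_iff hα, adjust]
  split_ifs with hlen
  · have hub' : ∀ b < α, ∃ c ∈ adjPt R x '' Iio (thinLen R x), b < c := by
      intro b hb
      obtain ⟨j, hj, hbj⟩ := hR.exists_lt_thin' hα hx hlen hb
      exact ⟨_, mem_image_of_mem _ (hlen.succ_lt hj),
        hbj.trans (hR.lt_adjPt hxα (hlen.succ_lt hj) (lt_succ j))⟩
    refine ⟨?_, hub', fun γ hγ hl => ?_⟩
    · rintro _ ⟨i, hi, rfl⟩
      exact (hR.adjPt_le hxα hi).trans_lt (hxα (hR.thin_mem_of_lt hxα hi).1)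
    -- The first index at which the adjusted points reach `γ` is a limit, so continuity of thinning
    -- puts its point at `γ` exactly.
    · have hne : {i | i < thinLen R x ∧ γ ≤ adjPt R x i}.Nonempty := by
        obtain ⟨_, ⟨i, hi, rfl⟩, h⟩ := hub' γ hγ
        exact ⟨i, hi, h.le⟩
      set i := sInf {i | i < thinLen R x ∧ γ ≤ adjPt R x i}
      obtain ⟨hi, hγi⟩ : i < thinLen R x ∧ γ ≤ adjPt R x i := csInf_mem hne
      have hlt : ∀ j < i, adjPt R x j < γ := fun j hj => by
        by_contra hge
        exact notMem_of_lt_csInf hj (OrderBot.bddBelow _) ⟨hj.trans hi, not_lt.1 hge⟩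
      have hil := hR.isSuccLimit_of_isLimitPt hxα hi hl hγi hlt
      refine ⟨i, hi, le_antisymm (not_lt.1 fun hgt => ?_) hγi⟩
      rw [adjPt_of_isSuccPrelimit hil.isSuccPrelimit] at hgt
      obtain ⟨j, hj, h⟩ := hR.exists_lt_thin hα hx hil hi hgt
      exact absurd (hlt _ (hil.succ_lt hj))
        (not_lt.2 (h.trans (hR.lt_adjPt hxα ((hil.succ_lt hj).trans hi) (lt_succ j))).le)
  · obtain ⟨k, hk⟩ := hR.exists_thinLen_eq_succ hα hx hlen
    have hkl : k < thinLen R x := hk ▸ lt_succ k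
    have htail : ∀ g, thin R x k ≤ g → ∀ j < thinLen R x, thin R x j ≤ g := fun g hg j hj =>
      ((hR.strictMonoOn_thin hxα).monotoneOn hj hkl (lt_succ_iff.1 (hk ▸ hj))).trans hg
    refine ⟨fun g hg => hxα hg.1, fun b hb => ?_, fun γ hγ hl => ?_⟩
    · obtain ⟨c, hc, h⟩ := hub _ (max_lt hb (hxα (hR.thin_mem_of_lt hxα hkl).1))
      exact ⟨c, ⟨hc, htail c ((le_max_right _ _).trans h.le)⟩, (le_max_left _ _).trans_lt h⟩
    · refine ⟨hcl γ hγ (hl.mono fun g hg => hg.1), fun j hj => ?_⟩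
      obtain ⟨c, hc, -, h⟩ := hl.2 0 (pos_iff_ne_zero.2 hl.1)
      exact (hc.2 j hj).trans h.le

theorem otp_adjust_le (hx : x ⊆ Iio α) : otp (adjust R x) ≤ otp x := by
  rw [adjust]
  split_ifs
  · rw [otp_image (hR.strictMonoOn_adjPt hx)]
    exact otp_le_of_strictMonoOn _ (hR.strictMonoOn_thin hx)
      fun i hi => (hR.thin_mem_of_lt hx hi).1
  · exact otp_mono fun g hg => hg.1

/-! ### Initial parts of a club -/

theorem thinSet_inter (h : ∀ j < i, thin R (x ∩ Iio β) j = thin R x j) :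
    thinSet R (x ∩ Iio β) i = thinSet R x i ∩ Iio β := by
  ext g
  constructor
  · rintro ⟨hg, hR'⟩
    refine ⟨⟨hg.1, fun j hj => ?_⟩, hg.2⟩
    obtain ⟨ξ, hξ⟩ := hR' j hj
    rw [h j hj, hR.inter_iff hg.2] at hξ
    exact ⟨ξ, hξ⟩
  · rintro ⟨hg, hgβ⟩
    refine ⟨⟨hg.1, hgβ⟩, fun j hj => ?_⟩
    obtain ⟨ξ, hξ⟩ := hg.2 j hj
    rw [h j hj]
    exact ⟨ξ, (hR.inter_iff hgβ).2 hξ⟩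

theorem thin_inter (hx : x ⊆ Iio α) (hi : i < thinLen R x) (hβ : thin R x i < β) :
    thin R (x ∩ Iio β) i = thin R x i := by
  induction i using WellFoundedLT.induction with
  | ind i ih =>
    have h := hR.thinSet_inter (x := x) (β := β) (i := i)
      fun j hj => ih j hj (hj.trans hi) ((hR.thin_lt_thin hx hi hj).trans hβ)
    have hmem := hR.thin_mem_of_lt hx hi
    refine le_antisymm (thin_le (h ▸ ⟨hmem, hβ⟩)) (thin_le ?_)
    have := thin_mem (R := R) (x := x ∩ Iio β) (i := i) (h ▸ ⟨_, hmem, hβ⟩)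
    rw [h] at this
    exact this.1

/-- Thinning `x ∩ Iio β` repeats the steps of thinning `x` for as long as these stay below `β`, and
stops once no candidate below `β` is left. -/
theorem thinLen_inter (hx : x ⊆ Iio α) (hi : i ≤ thinLen R x) (hβ : ∀ j < i, thin R x j < β)
    (hemp : thinSet R x i ∩ Iio β = ∅) : thinLen R (x ∩ Iio β) = i := by
  have hthin : ∀ j < i, thin R (x ∩ Iio β) j = thin R x j := fun j hj =>
    hR.thin_inter hx (hj.trans_le hi) (hβ j hj)
  have hx' : x ∩ Iio β ⊆ Iio α := inter_subset_left.trans hx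
  refine le_antisymm (not_lt.1 fun h => ?_) (le_of_forall_lt fun j hj => ?_)
  · rw [hR.lt_thinLen_iff hx', hR.thinSet_inter hthin, hemp] at h
    exact not_nonempty_empty h
  · rw [hR.lt_thinLen_iff hx', hR.thinSet_inter fun k hk => hthin k (hk.trans hj)]
    exact ⟨_, hR.thin_mem_of_lt hx (hj.trans_le hi), hβ j hj⟩

theorem adjPt_inter (hx : x ⊆ Iio α) (hi : i < thinLen R x) (hβ : thin R x i < β) :
    adjPt R (x ∩ Iio β) i = adjPt R x i := by
  by_cases hlim : IsSuccPrelimit i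
  · rw [adjPt_of_isSuccPrelimit hlim, adjPt_of_isSuccPrelimit hlim, hR.thin_inter hx hi hβ]
  · obtain ⟨j, rfl⟩ := not_isSuccPrelimit_iff_mem_range_succ.1 hlim
    have hj := (lt_succ j).trans hi
    rw [adjPt_succ, adjPt_succ, midPt, midPt, hR.thin_inter hx hi hβ,
      hR.thin_inter hx hj ((hR.thin_lt_thin hx hi (lt_succ j)).trans hβ)]
    simp_rw [hR.inter_iff hβ]

theorem adjust_inter_thin (hx : IsClubIn x α) (hi : IsSuccLimit i)
    (hlen : i < thinLen R x) :
    adjust R (x ∩ Iio (thin R x i)) = adjPt R x '' Iio i := by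
  have hthin : ∀ j < i, thin R x j < thin R x i := fun j hj => hR.thin_lt_thin hx.1 hlen hj
  have h : thinLen R (x ∩ Iio (thin R x i)) = i := by
    refine hR.thinLen_inter hx.1 hlen.le hthin ?_
    rw [← disjoint_iff_inter_eq_empty, Set.disjoint_left]
    exact fun g hg hlt => absurd (thin_le hg) (not_le.2 hlt)
  rw [adjust, h, if_pos hi]
  exact image_congr fun j hj => hR.adjPt_inter hx.1 (lt_trans hj hlen) (hthin j hj)

theorem isLimitPt_thin (hα : IsSuccLimit α) (hx : IsClubIn x α) (hi : IsSuccLimit i)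
    (hlen : i < thinLen R x) : IsLimitPt x (thin R x i) := by
  refine ⟨(bot_le.trans_lt (hR.thin_lt_thin hx.1 hlen hi.bot_lt)).ne', fun b hb => ?_⟩
  obtain ⟨j, hj, h⟩ := hR.exists_lt_thin hα hx hi hlen hb
  exact ⟨_, (hR.thin_mem_of_lt hx.1 (hj.trans hlen)).1, h, hR.thin_lt_thin hx.1 hlen hj⟩

/-- Coherence. In the limit case `β` is a kept point of limit index `i`, and thinning `x ∩ Iio β`
makes exactly the first `i` steps. In the stuck case `β` lies above all kept points, and thinning `x
∩ Iio β` gets stuck at the same stage. -/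
theorem acc_adjust (hα : IsSuccLimit α) (hx : IsClubIn x α) (hβ : β ∈ acc (adjust R x)) :
    β ∈ acc x ∧ adjust R (x ∩ Iio β) = adjust R x ∩ Iio β := by
  obtain ⟨hxα, hub, hcl⟩ := (isClubIn_iff hα).1 hx
  obtain ⟨hβ, hl⟩ := mem_acc_iff.1 hβ
  by_cases hlen : IsSuccLimit (thinLen R x)
  · have hadj : adjust R x = adjPt R x '' Iio (thinLen R x) := by rw [adjust, if_pos hlen]
    rw [hadj] at hβ hl ⊢
    obtain ⟨i, hi, rfl⟩ := hβ
    have hmono := hR.strictMonoOn_adjPt hxα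
    have hil := hR.isSuccLimit_of_isLimitPt hxα hi hl le_rfl
      fun j hj => hmono (mem_Iio.2 (hj.trans hi)) hi hj
    have hthin : adjPt R x i = thin R x i := adjPt_of_isSuccPrelimit hil.isSuccPrelimit
    refine ⟨mem_acc_iff.2 (hthin ▸ ⟨(hR.thin_mem_of_lt hxα hi).1,
      hR.isLimitPt_thin hα hx hil hi⟩), ?_⟩
    rw [hthin, hR.adjust_inter_thin hx hil hi, ← hthin]
    ext a
    constructor
    · rintro ⟨j, hj, rfl⟩
      exact ⟨⟨j, mem_Iio.2 (lt_trans hj hi), rfl⟩, hmono (mem_Iio.2 (lt_trans hj hi)) hi hj⟩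
    · rintro ⟨⟨j, hj, rfl⟩, h⟩
      exact ⟨j, (hmono.lt_iff_lt hj hi).1 h, rfl⟩
  · obtain ⟨k, hk⟩ := hR.exists_thinLen_eq_succ hα hx hlen
    have hadj : adjust R x = {g | g ∈ x ∧ ∀ j < thinLen R x, thin R x j ≤ g} := by
      rw [adjust, if_neg hlen]
    rw [hadj] at hβ hl ⊢
    refine ⟨mem_acc_iff.2 ⟨hβ.1, hl.mono fun g hg => hg.1⟩, ?_⟩
    obtain ⟨c, hc, -, hcβ⟩ := hl.2 0 (pos_iff_ne_zero.2 hl.1)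
    have hthin : ∀ j < thinLen R x, thin R x j < β := fun j hj => (hc.2 j hj).trans_lt hcβ
    have hlen' : thinLen R (x ∩ Iio β) = thinLen R x :=
      hR.thinLen_inter hxα le_rfl hthin (by rw [hR.thinSet_thinLen hxα, empty_inter])
    rw [adjust, hlen', if_neg hlen]
    ext g
    constructor
    · rintro ⟨hg, h⟩
      exact ⟨⟨hg.1, fun j hj => hR.thin_inter hxα hj (hthin j hj) ▸ h j hj⟩, hg.2⟩
    · rintro ⟨⟨hg, h⟩, hgβ⟩
      exact ⟨⟨hg, hgβ⟩, fun j hj => (hR.thin_inter hxα hj (hthin j hj)).symm ▸ h j hj⟩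

end IsStepRel

end thinning

/-! ### Cardinal arithmetic -/

theorem exists_bound {θ α : Ordinal.{u}} {f : Ordinal.{u} → Ordinal.{u}} (hθ : θ.card < α.cof)
    (hf : ∀ i < θ, f i < α) : ∃ b < α, ∀ i < θ, f i < b := by
  have hcard : #(f '' Iio θ) < (Ordinal.lift.{u + 1} α).cof := by
    refine mk_image_le.trans_lt ?_
    rw [Cardinal.mk_Iio_ordinal, ← lift_cof, Cardinal.lift_lt]
    exact hθ
  refine ⟨_, sSup_add_one_lt_of_lt_cof hcard (by rintro _ ⟨i, hi, rfl⟩; exact hf i hi),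
    fun i hi => ?_⟩
  rw [← add_one_le_iff]
  exact le_csSup (bddAbove_of_small) ⟨f i, ⟨i, hi, rfl⟩, rfl⟩

theorem cof_ord_succ {κ : Cardinal.{u}} (hκ : ℵ₀ ≤ κ) : (succ κ).ord.cof = succ κ :=
  (isRegular_succ hκ).cof_ord

theorem card_lt_cof_ord_succ {κ : Cardinal.{u}} (hκ : ℵ₀ ≤ κ) {j : Ordinal.{u}}
    (hj : j < (succ κ).ord) : j.card < (succ κ).ord.cof := by
  rw [cof_ord_succ hκ]
  exact lt_ord.1 hj

theorem ord_lt_ord_succ (κ : Cardinal.{u}) : κ.ord < (succ κ).ord :=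
  ord_lt_ord.2 (lt_succ κ)

/-- Injections of the ordinals below `κ⁺` into `κ`. -/
theorem exists_injections (κ : Cardinal.{u}) :
    ∃ e : Ordinal.{u} → Ordinal.{u} → Ordinal.{u}, ∀ μ < (succ κ).ord,
      (∀ η < μ, e μ η < κ.ord) ∧ InjOn (e μ) (Iio μ) := by
  have : ∀ μ : Ordinal.{u}, ∃ f : Ordinal.{u} → Ordinal.{u}, μ < (succ κ).ord →
      (∀ η < μ, f η < κ.ord) ∧ InjOn f (Iio μ) := by
    intro μ
    by_cases hμ : μ < (succ κ).ord
    · have hle : #(Iio μ) ≤ #(Iio κ.ord) := by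
        rw [Cardinal.mk_Iio_ordinal, Cardinal.mk_Iio_ordinal, card_ord, Cardinal.lift_le]
        exact lt_succ_iff.1 (lt_ord.1 hμ)
      obtain ⟨g⟩ := hle
      refine ⟨fun η => if h : η < μ then g ⟨η, h⟩ else 0, fun _ => ⟨fun η hη => ?_, ?_⟩⟩
      · simp only [dif_pos hη]
        exact (g ⟨η, hη⟩).2
      · intro a ha b hb hab
        simp only [dif_pos (mem_Iio.1 ha), dif_pos (mem_Iio.1 hb)] at hab
        exact congrArg Subtype.val (g.injective (Subtype.ext hab))
    · exact ⟨id, fun h => absurd h hμ⟩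
  choose e he using this
  exact ⟨e, he⟩

/-- If `κ ^ κ = κ⁺`, then all functions from `κ × j × κ` to `κ⁺`, where `j < κ⁺`, can be coded by
ordinals below `κ⁺`. -/
theorem exists_codes {κ : Cardinal.{u}} (hκ : ℵ₀ ≤ κ) (hpow : κ ^ κ = succ κ) :
    ∃ S : Ordinal.{u} → Ordinal.{u} → Ordinal.{u} → Ordinal.{u} → Ordinal.{u},
      ∀ j < (succ κ).ord, ∀ G : Ordinal.{u} → Ordinal.{u} → Ordinal.{u} → Ordinal.{u},
        (∀ τ < κ.ord, ∀ q < j, ∀ i < κ.ord, G τ q i < (succ κ).ord) →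
          ∃ η < (succ κ).ord, ∀ τ < κ.ord, ∀ q < j, ∀ i < κ.ord, S η τ q i = G τ q i := by
  classical
  let Φ : Type (u + 1) :=
    Σ j : Iio (succ κ).ord, (Iio κ.ord × Iio (j : Ordinal.{u}) × Iio κ.ord → Iio (succ κ).ord)
  have hκ' : ℵ₀ ≤ Cardinal.lift.{u + 1} κ := by simpa using hκ
  have hfib : ∀ j : Iio (succ κ).ord,
      #(Iio κ.ord × Iio (j : Ordinal.{u}) × Iio κ.ord → Iio (succ κ).ord) ≤
        Cardinal.lift.{u + 1} (succ κ) := by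
    intro j
    have hj : (j : Ordinal.{u}).card ≤ κ := lt_succ_iff.1 (lt_ord.1 j.2)
    have h1 : #(Iio κ.ord × Iio (j : Ordinal.{u}) × Iio κ.ord) ≤ Cardinal.lift.{u + 1} κ := by
      simp only [mk_prod, Cardinal.mk_Iio_ordinal, card_ord, Cardinal.lift_id]
      exact mul_le_of_le hκ' le_rfl (mul_le_of_le hκ' (Cardinal.lift_le.2 hj) le_rfl)
    rw [← power_def, Cardinal.mk_Iio_ordinal, card_ord]
    refine (power_le_power_left ?_ h1).trans ?_
    · simp
    · rw [← lift_power, Cardinal.lift_le, ← hpow, ← power_mul, mul_eq_self hκ]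
  -- There are `κ⁺` lengths `j`, and for each of them at most `(κ⁺) ^ κ = (κ ^ κ) ^ κ = κ⁺`
  -- functions.
  have hΦ : #Φ ≤ #(Iio (succ κ).ord) := by
    have h2 : ℵ₀ ≤ Cardinal.lift.{u + 1} (succ κ) :=
      aleph0_le_lift.2 (hκ.trans (le_succ κ))
    rw [mk_sigma, Cardinal.mk_Iio_ordinal, card_ord]
    refine (sum_le_sum _ _ hfib).trans ?_
    rw [sum_const, Cardinal.mk_Iio_ordinal, card_ord]
    simpa only [Cardinal.lift_id, Cardinal.lift_lift] using (mul_eq_self h2).le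
  obtain ⟨enc⟩ := hΦ
  have hpos : 0 < (succ κ).ord := by
    rw [pos_iff_ne_zero, Ne, ord_eq_zero]
    exact (succ_ne_bot κ)
  have : Nonempty Φ := ⟨⟨⟨0, hpos⟩, fun _ => ⟨0, hpos⟩⟩⟩
  let dec : Φ → Ordinal.{u} → Ordinal.{u} → Ordinal.{u} → Ordinal.{u} := fun p τ q i =>
    if h : τ < κ.ord ∧ q < p.1 ∧ i < κ.ord then p.2 (⟨τ, h.1⟩, ⟨q, h.2.1⟩, ⟨i, h.2.2⟩) else 0
  refine ⟨fun η => if h : η < (succ κ).ord then dec (Function.invFun enc ⟨η, h⟩)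
    else fun _ _ _ => 0, fun j hj G hG => ?_⟩
  let p : Φ := ⟨⟨j, hj⟩, fun t => ⟨G t.1 t.2.1 t.2.2, hG _ t.1.2 _ t.2.1.2 _ t.2.2.2⟩⟩
  refine ⟨enc p, (enc p).2, fun τ hτ q hq i hi => ?_⟩
  have hp : Function.invFun enc ⟨(enc p : Ordinal.{u}), (enc p).2⟩ = p :=
    Function.leftInverse_invFun enc.injective p
  dsimp only
  rw [dif_pos (mem_Iio.1 (enc p).2), hp]
  exact dif_pos ⟨hτ, hq, hi⟩

/-- Every map from `κ⁺` to `κ` has a fibre which has `κ` elements below some ordinal less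
than `κ⁺`. -/
theorem exists_large_fibre {κ : Cardinal.{u}} (hκ : ℵ₀ ≤ κ) {f : Ordinal.{u} → Ordinal.{u}}
    (hf : ∀ q < (succ κ).ord, f q < κ.ord) :
    ∃ θ < κ.ord, ∃ j < (succ κ).ord, Cardinal.lift.{u + 1} κ ≤ #{q | q < j ∧ f q = θ} := by
  have hreg : (Cardinal.lift.{u + 1} (succ κ)).IsRegular := (isRegular_succ hκ).lift
  have hcard : #(Iio (succ κ).ord) = Cardinal.lift.{u + 1} (succ κ) := by
    rw [Cardinal.mk_Iio_ordinal, card_ord]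
  obtain ⟨⟨θ, hθ⟩, h⟩ := infinite_pigeonhole
    (fun q : Iio (succ κ).ord => (⟨f q, hf q q.2⟩ : Iio κ.ord))
    (by rw [hcard]; exact hreg.aleph0_le)
    (by
      rw [hcard, hreg.cof_ord, Cardinal.mk_Iio_ordinal, card_ord, Cardinal.lift_lt]
      exact lt_succ κ)
  rw [hcard] at h
  obtain ⟨p, hp, hpc⟩ := le_mk_iff_exists_subset.1
    ((Cardinal.lift_le.2 (le_succ κ)).trans h.ge)
  have hlt : #(Subtype.val '' p : Set Ordinal.{u}) < (Ordinal.lift.{u + 1} (succ κ).ord).cof := by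
    rw [mk_image_eq Subtype.val_injective, hpc, ← lift_cof, cof_ord_succ hκ, Cardinal.lift_lt]
    exact lt_succ κ
  refine ⟨θ, hθ, _, sSup_add_one_lt_of_lt_cof hlt (by rintro _ ⟨q, -, rfl⟩; exact q.2), ?_⟩
  rw [← hpc, ← mk_image_eq (s := p) Subtype.val_injective]
  refine mk_le_mk_of_subset ?_
  rintro _ ⟨q, hq, rfl⟩
  refine ⟨?_, congrArg Subtype.val (hp hq)⟩
  rw [← add_one_le_iff]
  exact le_csSup bddAbove_of_small ⟨q, ⟨q, hq, rfl⟩, rfl⟩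

/-- Dependent choice along the ordinals. -/
theorem exists_rec {β : Type*} [Inhabited β] (P : Ordinal.{u} → (Ordinal.{u} → β) → β → Prop)
    (hP : ∀ q G G', (∀ p < q, G p = G' p) → ∀ g, P q G g → P q G' g)
    (h : ∀ q G, ∃ g, P q G g) : ∃ G : Ordinal.{u} → β, ∀ q, P q G (G q) := by
  classical
  choose c hc using h
  let G : Ordinal.{u} → β := WellFounded.fix (C := fun _ => β) (wellFounded_lt (α := Ordinal.{u}))
    fun q F => c q fun p => if h : p < q then F p h else default
  have hG : ∀ q, G q = c q fun p => if p < q then G p else default := by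
    intro q
    simp only [G]
    rw [WellFounded.fix_eq]
    rfl
  refine ⟨G, fun q => ?_⟩
  rw [hG q]
  -- The truncation to `default` from `q` on is invisible to `P q`.
  exact hP q _ _ (fun p hp => if_pos hp) _ (hc q _)

/-! ### The step relations that are used for guessing -/

/-- A small set of ordinals below `γ` which is determined by `x ∩ γ`. -/
def smallSet (e : Ordinal.{u} → Ordinal.{u} → Ordinal.{u}) (τ : Ordinal.{u})
    (x : Set Ordinal.{u}) (γ : Ordinal.{u}) : Set Ordinal.{u} :=
  {η | ∃ μ ∈ x, μ < γ ∧ η < μ ∧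
    (e μ η < τ ∨ Ordinal.lift.{u + 1} (e μ η) < otp (x ∩ Iio γ))}

theorem smallSet_mono {e : Ordinal.{u} → Ordinal.{u} → Ordinal.{u}} {τ : Ordinal.{u}}
    {x : Set Ordinal.{u}} {γ γ' : Ordinal.{u}} (h : γ ≤ γ') :
    smallSet e τ x γ ⊆ smallSet e τ x γ' := by
  rintro η ⟨μ, hμ, h1, h2, h3⟩
  exact ⟨μ, hμ, h1.trans_le h, h2, h3.imp_right fun h3 =>
    h3.trans_le (otp_mono (inter_subset_inter_right x (Iio_subset_Iio h)))⟩

theorem smallSet_inter {e : Ordinal.{u} → Ordinal.{u} → Ordinal.{u}} {τ : Ordinal.{u}}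
    {x : Set Ordinal.{u}} {γ β : Ordinal.{u}} (h : γ ≤ β) :
    smallSet e τ (x ∩ Iio β) γ = smallSet e τ x γ := by
  have : x ∩ Iio β ∩ Iio γ = x ∩ Iio γ := by rw [inter_assoc, Iio_inter_Iio, min_eq_right h]
  ext η
  rw [smallSet, smallSet, this]
  constructor
  · rintro ⟨μ, hμ, h1, h2⟩
    exact ⟨μ, hμ.1, h1, h2⟩
  · rintro ⟨μ, hμ, h1, h2⟩
    exact ⟨μ, ⟨hμ, h1.trans_le h⟩, h1, h2⟩

theorem mk_inter_lt {κ : Cardinal.{u}} {x : Set Ordinal.{u}} {γ : Ordinal.{u}} (hγ : γ ∈ x)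
    (hx : otp x ≤ Ordinal.lift.{u + 1} κ.ord) : #↥(x ∩ Iio γ) < Cardinal.lift.{u + 1} κ := by
  obtain ⟨o, ho, h⟩ := Ordinal.lt_lift_iff.1 ((otp_inter_lt hγ).trans_le hx)
  rw [← card_otp, ← h, ← lift_card, Cardinal.lift_lt]
  exact lt_ord.1 ho

/-- A member `η` is determined by its witness `μ` in `x ∩ Iio γ` and the value `e μ η`, which lies
below the larger of `τ` and the order type of `x ∩ Iio γ`. -/
theorem mk_smallSet_lt {κ : Cardinal.{u}} (hκ : ℵ₀ ≤ κ)
    {e : Ordinal.{u} → Ordinal.{u} → Ordinal.{u}}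
    (he : ∀ μ < (succ κ).ord, (∀ η < μ, e μ η < κ.ord) ∧ InjOn (e μ) (Iio μ))
    {τ : Ordinal.{u}} (hτ : τ < κ.ord) {x : Set Ordinal.{u}} (hx : x ⊆ Iio (succ κ).ord)
    (hotp : otp x ≤ Ordinal.lift.{u + 1} κ.ord) {γ : Ordinal.{u}} (hγ : γ ∈ x) :
    #(smallSet e τ x γ) < Cardinal.lift.{u + 1} κ := by
  obtain ⟨o, ho, h⟩ := Ordinal.lt_lift_iff.1 ((otp_inter_lt hγ).trans_le hotp)
  have key : ∀ η : smallSet e τ x γ, ∃ p : ↥(x ∩ Iio γ) × Iio (max τ o),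
      η.1 < p.1 ∧ e p.1 η = p.2 := by
    rintro ⟨η, μ, hμ, h1, h2, h3⟩
    refine ⟨⟨⟨μ, hμ, h1⟩, ⟨e μ η, lt_max_iff.2 (h3.imp_right fun h3 => ?_)⟩⟩, h2, rfl⟩
    rwa [← h, Ordinal.lift_lt] at h3
  choose p hp using key
  have hinj : Function.Injective p := by
    intro a b hab
    have h1 := hp a
    have h2 := hp b
    rw [← hab] at h2
    exact Subtype.ext ((he _ (hx (p a).1.2.1)).2 h1.1 h2.1 (h1.2.trans h2.2.symm))
  refine (mk_le_of_injective hinj).trans_lt ?_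
  rw [mk_prod, Cardinal.lift_id, Cardinal.lift_id]
  refine mul_lt_of_lt (aleph0_le_lift.2 hκ) (mk_inter_lt hγ hotp) ?_
  rw [Cardinal.mk_Iio_ordinal, Cardinal.lift_lt]
  exact lt_ord.1 (max_lt hτ ho)

/-- The step relation for the `q`-th attempt at guessing: the functions `G p` for `p < q` are those
which were not guessed by the earlier attempts. A candidate is a point `δ` of `x` with a code `η` in
the small set which is right about the earlier functions at `δ`. -/
def attempt (e : Ordinal.{u} → Ordinal.{u} → Ordinal.{u})
    (S : Ordinal.{u} → Ordinal.{u} → Ordinal.{u} → Ordinal.{u}) (τ q : Ordinal.{u})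
    (G : Ordinal.{u} → Ordinal.{u} → Ordinal.{u} → Ordinal.{u})
    (x : Set Ordinal.{u}) (i d g ξ : Ordinal.{u}) : Prop :=
  ∃ δ ∈ x, d ≤ δ ∧ ∃ η ∈ smallSet e τ x g,
    (∀ p < q, S η p i = G p δ i) ∧ δ < ξ ∧ ξ < g ∧ ξ = S η q i

section attempt

variable {e : Ordinal.{u} → Ordinal.{u} → Ordinal.{u}}
  {S : Ordinal.{u} → Ordinal.{u} → Ordinal.{u} → Ordinal.{u}} {τ q : Ordinal.{u}}
  {G : Ordinal.{u} → Ordinal.{u} → Ordinal.{u} → Ordinal.{u}}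

/-- Monotonicity holds because the small sets grow with `g`. Locality holds because `δ < ξ < g`, so
every witness lies in the initial part of `x`. -/
theorem isStepRel_attempt : IsStepRel (attempt e S τ q G) where
  lt_left := by
    rintro x i d g ξ ⟨δ, -, h, η, -, -, h', -⟩
    exact h.trans_lt h'
  lt_right := by
    rintro x i d g ξ ⟨δ, -, -, η, -, -, -, h, -⟩
    exact h
  mono := by
    rintro x i d g g' ξ hg ⟨δ, hδ, h1, η, hη, h2, h3, h4, h5⟩
    exact ⟨δ, hδ, h1, η, smallSet_mono hg hη, h2, h3, h4.trans_le hg, h5⟩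
  inter_iff := by
    intro x i d g ξ β hg
    rw [attempt, attempt, smallSet_inter hg.le]
    constructor
    · rintro ⟨δ, hδ, h⟩
      exact ⟨δ, hδ.1, h⟩
    · rintro ⟨δ, hδ, h1, η, hη, h2, h3, h4, h5⟩
      exact ⟨δ, ⟨hδ, h3.trans (h4.trans hg)⟩, h1, η, hη, h2, h3, h4, h5⟩

theorem attempt_anti {x : Set Ordinal.{u}} {i d d' g ξ : Ordinal.{u}} (hd : d ≤ d')
    (h : attempt e S τ q G x i d' g ξ) : attempt e S τ q G x i d g ξ :=
  let ⟨δ, hδ, h1, h2⟩ := h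
  ⟨δ, hδ, hd.trans h1, h2⟩

theorem attempt_congr {G' : Ordinal.{u} → Ordinal.{u} → Ordinal.{u} → Ordinal.{u}}
    (h : ∀ p < q, G p = G' p) : attempt e S τ q G = attempt e S τ q G' := by
  ext x i d g ξ
  have : ∀ η δ, (∀ p < q, S η p i = G p δ i) ↔ ∀ p < q, S η p i = G' p δ i := fun η δ =>
    forall₂_congr fun p hp => by rw [h p hp]
  simp only [attempt, this]

end attempt

/-! ### Guessing for one label -/

/-- A largeness property of the point `α`, whose club is `x`. -/
def IsGood (κ k : Cardinal.{u}) (x : Set Ordinal.{u}) (α : Ordinal.{u}) : Prop :=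
  k ≤ α.cof ∧ ∀ v : Ordinal.{u} → Ordinal.{u}, (∀ δ < α, v δ < κ.ord) →
    ∃ τ < κ.ord, ∀ b < α, ∃ δ ∈ x, b ≤ δ ∧
      ∃ γ ∈ x, v δ < τ ∨ Ordinal.lift.{u + 1} (v δ) < otp (x ∩ Iio γ)

variable {κ k : Cardinal.{u}} {x : Ordinal.{u} → Set Ordinal.{u}} {L : Type*}
  {l : Ordinal.{u} → L} {z : L}

/-- The members of `P` which come from clubs `x β` with `l β = z` do not guess `g` at `θ`. -/
def Misses (κ : Cardinal.{u}) (x : Ordinal.{u} → Set Ordinal.{u}) (l : Ordinal.{u} → L) (z : L)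
    (R : Set Ordinal.{u} → Ordinal.{u} → Ordinal.{u} → Ordinal.{u} → Ordinal.{u} → Prop)
    (θ : Ordinal.{u}) (g : Ordinal.{u} → Ordinal.{u} → Ordinal.{u}) : Prop :=
  ∀ β < (succ κ).ord, IsSuccLimit β → l β = z → otp (adjust R (x β)) = Ordinal.lift.{u + 1} θ →
    ∃ i < θ, ∀ δ < (succ κ).ord, nth (adjust R (x β)) i ≤ δ →
      nth (adjust R (x β)) (i + 1) ≠ g δ i

theorem IsSquareSeq.mem_acc (hx : IsSquareSeq κ x) {α β : Ordinal.{u}} (hα : α < (succ κ).ord)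
    (hα' : IsSuccLimit α) (hβ : β ∈ acc (x α)) :
    β < (succ κ).ord ∧ IsSuccLimit β ∧ x β = x α ∩ Iio β := by
  obtain ⟨h1, -, h2⟩ := hx α hα hα'
  exact ⟨(h1.1 hβ.1).trans hα, (mem_acc_iff.1 hβ).2.isSuccLimit, h2 β hβ⟩

/-- All attempts which started from the same function `e`, the same codes `S` and the same
bound `τ` proceed with a common speed in a club of a good point. -/
theorem exists_bound_thin {e : Ordinal.{u} → Ordinal.{u} → Ordinal.{u}}
    {S : Ordinal.{u} → Ordinal.{u} → Ordinal.{u} → Ordinal.{u}} {τ J α : Ordinal.{u}}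
    {G : Ordinal.{u} → Ordinal.{u} → Ordinal.{u} → Ordinal.{u}} {y : Set Ordinal.{u}}
    (hα : IsSuccLimit α) (hy : IsClubIn y α) (hk : k ≤ α.cof)
    (hspeed : ∀ d < α, ∃ γ ∈ y, ∀ q < J, ∀ i < k.ord, ∃ ξ, attempt e S τ q G y i d γ ξ) :
    ∀ θ < k.ord, ∃ γ ∈ y, ∀ q < J, θ < thinLen (attempt e S τ q G) y ∧
      thin (attempt e S τ q G) y θ ≤ γ := by
  obtain ⟨hyα, hub, -⟩ := (isClubIn_iff hα).1 hy
  have : ∀ d, ∃ γ, d < α → γ ∈ y ∧ ∀ q < J, ∀ i < k.ord, ∃ ξ, attempt e S τ q G y i d γ ξ := by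
    intro d
    by_cases hd : d < α
    · obtain ⟨γ, hγ⟩ := hspeed d hd
      exact ⟨γ, fun _ => hγ⟩
    · exact ⟨0, fun h => absurd h hd⟩
  choose s hs using this
  -- One sequence in `y`, not depending on `q`, that is slow enough for all `q < J` at once. It
  -- stays below `α` because its length is less than `k ≤ α.cof`.
  obtain ⟨b, hb⟩ := exists_rec (β := Ordinal.{u})
    (fun i b c => i < k.ord → (∀ j < i, b j < α) → c ∈ y ∧ ∀ j < i, s (b j) ≤ c)
    (by
      intro i b b' hbb' c hc hi hb'
      have h := hc hi fun j hj => (hbb' j hj).symm ▸ hb' j hj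
      exact ⟨h.1, fun j hj => hbb' j hj ▸ h.2 j hj⟩)
    (by
      intro i b
      by_cases hi : i < k.ord ∧ ∀ j < i, b j < α
      · obtain ⟨c, hc, h⟩ := exists_bound (θ := i) (α := α) (f := fun j => s (b j))
          ((lt_ord.1 hi.1).trans_le hk) fun j hj => hyα (hs _ (hi.2 j hj)).1
        obtain ⟨c', hc', hcc'⟩ := hub c hc
        exact ⟨c', fun _ _ => ⟨hc', fun j hj => ((h j hj).trans hcc').le⟩⟩
      · exact ⟨0, fun h1 h2 => absurd ⟨h1, h2⟩ hi⟩)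
  have hmem : ∀ i < k.ord, b i ∈ y := by
    intro i
    induction i using WellFoundedLT.induction with
    | ind i ih => exact fun hi => (hb i hi fun j hj => hyα (ih j hj (hj.trans hi))).1
  have hle : ∀ i < k.ord, ∀ j < i, s (b j) ≤ b i := fun i hi =>
    (hb i hi fun j hj => hyα (hmem j (hj.trans hi))).2
  intro θ hθ
  refine ⟨b θ, hmem θ hθ, fun q hq => ?_⟩
  have hR := isStepRel_attempt (e := e) (S := S) (τ := τ) (q := q) (G := G)
  have key : ∀ i < k.ord, b i ∈ thinSet (attempt e S τ q G) y i := by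
    intro i
    induction i using WellFoundedLT.induction with
    | ind i ih =>
      refine fun hi => ⟨hmem i hi, fun j hj => ?_⟩
      have hjk := hj.trans hi
      obtain ⟨ξ, hξ⟩ := (hs (b j) (hyα (hmem j hjk))).2 q hq j hjk
      exact ⟨ξ, hR.mono (hle i hi j hj) (attempt_anti (thin_le (ih j hj hjk)) hξ)⟩
  exact ⟨(hR.lt_thinLen_iff hyα).2 ⟨_, key θ hθ⟩, thin_le (key θ hθ)⟩

/-- If `τ` is right for `y`, then fewer than `κ` of the attempts miss at `θ`. -/
theorem mk_misses_lt (hκ : ℵ₀ ≤ κ) (hkκ : k ≤ κ) (hx : IsSquareSeq κ x)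
    (hl : ∀ α < (succ κ).ord, IsSuccLimit α → ∀ β ∈ acc (x α), l β = l α)
    {e : Ordinal.{u} → Ordinal.{u} → Ordinal.{u}}
    (he : ∀ μ < (succ κ).ord, (∀ η < μ, e μ η < κ.ord) ∧ InjOn (e μ) (Iio μ))
    {S : Ordinal.{u} → Ordinal.{u} → Ordinal.{u} → Ordinal.{u}} {τ J α θ : Ordinal.{u}}
    {G : Ordinal.{u} → Ordinal.{u} → Ordinal.{u} → Ordinal.{u}} (hτ : τ < κ.ord)
    (hακ : α < (succ κ).ord) (hα : IsSuccLimit α) (hαz : l α = z) (hk : k ≤ α.cof)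
    (hspeed : ∀ d < α, ∃ γ ∈ x α, ∀ q < J, ∀ i < k.ord, ∃ ξ, attempt e S τ q G (x α) i d γ ξ)
    (hθ : θ < k.ord) (hθ' : IsSuccLimit θ) :
    #{q | q < J ∧ Misses κ x l z (attempt e S τ q G) θ (G q)} < Cardinal.lift.{u + 1} κ := by
  obtain ⟨hclub, hotp, -⟩ := hx α hακ hα
  have hsub : x α ⊆ Iio (succ κ).ord := hclub.1.trans (Iio_subset_Iio hακ.le)
  obtain ⟨γ, hγ, hthin⟩ := exists_bound_thin hα hclub hk hspeed θ hθ
  -- The point kept at index `θ` is an accumulation point of `x α`, and its own adjusted club has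
  -- order type `θ`. The missed index `i` comes with the `δ` and the code `η` that produced the
  -- element with index `i + 1`; being missed, this `η` is wrong about `G q` at `δ`.
  have key : ∀ q : {q | q < J ∧ Misses κ x l z (attempt e S τ q G) θ (G q)},
      ∃ t : Iio θ × ↥(x α ∩ Iio γ) × smallSet e τ (x α) γ,
        (∀ p < q.1, S t.2.2 p t.1 = G p t.2.1 t.1) ∧ S t.2.2 q t.1 ≠ G q t.2.1 t.1 := by
    rintro ⟨q, hqJ, hq⟩
    have hR := isStepRel_attempt (e := e) (S := S) (τ := τ) (q := q) (G := G)
    obtain ⟨hlen, hle⟩ := hthin q hqJ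
    have hacc : thin (attempt e S τ q G) (x α) θ ∈ acc (x α) :=
      mem_acc_iff.2 ⟨(hR.thin_mem_of_lt hclub.1 hlen).1, hR.isLimitPt_thin hα hclub hθ' hlen⟩
    obtain ⟨h1, h2, h3⟩ := hx.mem_acc hακ hα hacc
    have hmono := (hR.strictMonoOn_adjPt hclub.1).mono (Iio_subset_Iio hlen.le)
    obtain ⟨i, hi, hmiss⟩ := hq _ h1 h2 ((hl α hακ hα _ hacc).trans hαz)
      (by rw [h3, hR.adjust_inter_thin hclub hθ' hlen, otp_image hmono, otp_Iio])
    have hi' : succ i < θ := hθ'.succ_lt hi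
    rw [h3, hR.adjust_inter_thin hclub hθ' hlen, ← succ_eq_add_one, nth_image hmono hi,
      nth_image hmono hi', adjPt_succ] at hmiss
    obtain ⟨δ, hδ, hdδ, η, hη, hcons, h4, h5, h6⟩ := hR.midPt_spec hclub.1 (hi'.trans hlen)
    have hsl := hR.thin_lt_thin hclub.1 hlen hi'
    refine ⟨⟨⟨i, hi⟩, ⟨δ, hδ, h4.trans (h5.trans (hsl.trans_le hle))⟩,
      ⟨η, smallSet_mono (hsl.le.trans hle) hη⟩⟩, hcons, ?_⟩
    rw [h6] at hmiss
    exact hmiss δ (hsub hδ) ((hR.adjPt_le hclub.1 (hi.trans hlen)).trans hdδ)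
  choose t ht using key
  -- For the given `i` and `δ`, `q` is the first index about which the code is wrong.
  have hinj : Function.Injective t := by
    intro a b hab
    refine Subtype.ext (le_antisymm (not_lt.1 fun h => ?_) (not_lt.1 fun h => ?_))
    · exact (ht b).2 (hab ▸ (ht a).1 b h)
    · exact (ht a).2 (hab ▸ (ht b).1 a h)
  have hκ' : ℵ₀ ≤ Cardinal.lift.{u + 1} κ := aleph0_le_lift.2 hκ
  refine (mk_le_of_injective hinj).trans_lt ?_
  simp only [mk_prod, Cardinal.lift_id]
  refine mul_lt_of_lt hκ' ?_ (mul_lt_of_lt hκ' (mk_inter_lt hγ hotp)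
    (mk_smallSet_lt hκ he hτ hsub hotp hγ))
  rw [Cardinal.mk_Iio_ordinal, Cardinal.lift_lt]
  exact (lt_ord.1 hθ).trans_le hkκ

/-- If the label `z` is found at sufficiently many good points, then one of the attempts does not
miss anything at this label. -/
theorem exists_not_misses (hκ : ℵ₀ ≤ κ) (hpow : κ ^ κ = succ κ) (hkκ : k ≤ κ)
    (hx : IsSquareSeq κ x)
    (hl : ∀ α < (succ κ).ord, IsSuccLimit α → ∀ β ∈ acc (x α), l β = l α)
    (hz : ∀ h : Ordinal.{u} → Ordinal.{u}, (∀ δ < (succ κ).ord, h δ < (succ κ).ord) →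
      ∃ α < (succ κ).ord, IsSuccLimit α ∧ (∀ δ < α, h δ < α) ∧ l α = z ∧ IsGood κ k (x α) α) :
    ∃ R, IsStepRel R ∧ ∀ θ < k.ord, IsSuccLimit θ → ∀ g : Ordinal.{u} → Ordinal.{u} → Ordinal.{u},
      (∀ i < κ.ord, ∀ δ < (succ κ).ord, δ < g δ i ∧ g δ i < (succ κ).ord) →
        ¬ Misses κ x l z R θ g := by
  by_contra! hcon
  obtain ⟨e, he⟩ := exists_injections κ
  obtain ⟨S, hS⟩ := exists_codes hκ hpow
  have hrec : ∀ τ, ∃ F : Ordinal.{u} → Ordinal.{u} × (Ordinal.{u} → Ordinal.{u} → Ordinal.{u}),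
      ∀ q, (F q).1 < k.ord ∧ IsSuccLimit (F q).1 ∧
        (∀ i < κ.ord, ∀ δ < (succ κ).ord, δ < (F q).2 δ i ∧ (F q).2 δ i < (succ κ).ord) ∧
        Misses κ x l z (attempt e (fun η => S η τ) τ q fun p => (F p).2) (F q).1 (F q).2 := by
    intro τ
    refine exists_rec (β := Ordinal.{u} × (Ordinal.{u} → Ordinal.{u} → Ordinal.{u})) (fun q F f => f.1 < k.ord ∧ IsSuccLimit f.1 ∧
        (∀ i < κ.ord, ∀ δ < (succ κ).ord, δ < f.2 δ i ∧ f.2 δ i < (succ κ).ord) ∧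
        Misses κ x l z (attempt e (fun η => S η τ) τ q fun p => (F p).2) f.1 f.2) ?_ ?_
    · intro q F F' hF f hf
      rwa [attempt_congr (G' := fun p => (F p).2) fun p hp => by rw [hF p hp]]
    · intro q F
      obtain ⟨θ, h1, h2, g, h3, h4⟩ := hcon _ (isStepRel_attempt (e := e) (S := fun η => S η τ)
        (τ := τ) (q := q) (G := fun p => (F p).2))
      exact ⟨(θ, g), h1, h2, h3, h4⟩
  choose F hFk hFl hFg hFm using hrec
  have hfib : ∀ τ, ∃ θ < κ.ord, ∃ j < (succ κ).ord,
      Cardinal.lift.{u + 1} κ ≤ #{q | q < j ∧ (F τ q).1 = θ} := fun τ =>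
    exists_large_fibre hκ fun q _ => (hFk τ q).trans_le (ord_le_ord.2 hkκ)
  -- A common bound `J` for all `τ` is needed next, since one code has to cover every `τ`: the right
  -- `τ` is known only after `α` is chosen.
  choose θ hθ j hj hlarge using hfib
  have hκcof := card_lt_cof_ord_succ hκ (ord_lt_ord_succ κ)
  obtain ⟨J, hJ, hjJ⟩ := exists_bound (f := j) hκcof fun τ _ => hj τ
  -- `η δ` codes the values at `δ` of all counterexamples with `τ < κ` and `q < J`, and `m δ` bounds
  -- these values. `α` will be closed under both maps.
  have hh : ∀ δ, ∃ η m, δ < (succ κ).ord → η < (succ κ).ord ∧ m < (succ κ).ord ∧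
      (∀ τ < κ.ord, ∀ q < J, ∀ i < κ.ord, S η τ q i = (F τ q).2 δ i) ∧
      ∀ τ < κ.ord, ∀ q < J, ∀ i < κ.ord, (F τ q).2 δ i < m := by
    intro δ
    by_cases hδ : δ < (succ κ).ord
    · obtain ⟨η, hη, h⟩ := hS J hJ (fun τ q i => (F τ q).2 δ i)
        fun τ _ q _ i hi => (hFg τ q i hi δ hδ).2
      have h1 : ∀ τ q, ∃ m < (succ κ).ord, ∀ i < κ.ord, (F τ q).2 δ i < m := fun τ q =>
        exists_bound hκcof fun i hi => (hFg τ q i hi δ hδ).2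
      choose m1 hm1 hm1' using h1
      have h2 : ∀ τ, ∃ m < (succ κ).ord, ∀ q < J, m1 τ q < m := fun τ =>
        exists_bound (card_lt_cof_ord_succ hκ hJ) fun q _ => hm1 τ q
      choose m2 hm2 hm2' using h2
      obtain ⟨m, hm, hm'⟩ := exists_bound (f := m2) hκcof fun τ _ => hm2 τ
      exact ⟨η, m, fun _ => ⟨hη, hm, h, fun τ hτ q hq i hi =>
        (hm1' τ q i hi).trans ((hm2' τ q hq).trans (hm' τ hτ))⟩⟩
    · exact ⟨0, 0, fun h => absurd h hδ⟩
  choose η m hηm using hh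
  obtain ⟨α, hακ, hα, hclosed, hαz, hk, hgood⟩ := hz (fun δ => max (η δ) (m δ))
    fun δ hδ => max_lt (hηm δ hδ).1 (hηm δ hδ).2.1
  obtain ⟨hyα, hub, -⟩ := (isClubIn_iff hα).1 (hx α hακ hα).1
  have hμ : ∀ δ, ∃ μ, δ < α → μ ∈ x α ∧ η δ < μ := by
    intro δ
    by_cases hδ : δ < α
    · obtain ⟨μ, h1, h2⟩ := hub _ ((le_max_left _ _).trans_lt (hclosed δ hδ))
      exact ⟨μ, fun _ => ⟨h1, h2⟩⟩
    · exact ⟨0, fun h => absurd h hδ⟩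
  choose μ hμ using hμ
  -- Goodness is applied to the place in `κ` that the injection `e (μ δ)` gives to the true code `η
  -- δ`.
  obtain ⟨τ, hτ, hτ'⟩ := hgood (fun δ => e (μ δ) (η δ)) fun δ hδ =>
    (he (μ δ) ((hyα (hμ δ hδ).1).trans hακ)).1 _ (hμ δ hδ).2
  have hspeed : ∀ d < α, ∃ γ ∈ x α, ∀ q < J, ∀ i < k.ord,
      ∃ ξ, attempt e (fun η => S η τ) τ q (fun p => (F τ p).2) (x α) i d γ ξ := by
    intro d hd
    obtain ⟨δ, hδ, hdδ, γ₁, hγ₁, h⟩ := hτ' d hd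
    have hδα := hyα hδ
    -- Above `γ₁`, `μ δ` and `m δ` the small set contains the true code of `δ` and all coded values
    -- have been passed, so one `γ` works for all `q` and `i`.
    obtain ⟨γ, hγ, hlt⟩ := hub (max (max γ₁ (μ δ)) (m δ)) (max_lt (max_lt (hyα hγ₁)
      (hyα (hμ δ hδα).1)) ((le_max_right _ _).trans_lt (hclosed δ hδα)))
    simp only [max_lt_iff] at hlt
    obtain ⟨-, -, hcode, hbd⟩ := hηm δ (lt_trans hδα hακ)
    refine ⟨γ, hγ, fun q hq i hi => ⟨(F τ q).2 δ i, δ, hδ, hdδ, η δ,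
      ⟨μ δ, (hμ δ hδα).1, hlt.1.2, (hμ δ hδα).2, h.imp_right fun h => h.trans_le ?_⟩, ?_⟩⟩
    · have hi' := hi.trans_le (ord_le_ord.2 hkκ)
      exact ⟨fun p hp => hcode τ hτ p (hp.trans hq) i hi', (hFg τ q i hi' δ (lt_trans hδα hακ)).1,
        (hbd τ hτ q hq i hi').trans hlt.2, (hcode τ hτ q hq i hi').symm⟩
    · exact otp_mono (inter_subset_inter_right _ (Iio_subset_Iio hlt.1.1.le))
  -- Any member of the fibre shows that `θ τ` is a limit below `k.ord`.
  have hne : {q | q < j τ ∧ (F τ q).1 = θ τ}.Nonempty := by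
    rw [← nonempty_coe_sort, ← mk_ne_zero_iff]
    refine (lt_of_lt_of_le ?_ (hlarge τ)).ne'
    exact (aleph0_pos).trans_le (aleph0_le_lift.2 hκ)
  obtain ⟨q₀, -, hq₀⟩ := hne
  refine absurd ((hlarge τ).trans (mk_le_mk_of_subset ?_)) (not_le.2 (mk_misses_lt hκ hkκ hx hl he
    hτ hακ hα hαz hk hspeed (hq₀ ▸ hFk τ q₀) (hq₀ ▸ hFl τ q₀)))
  rintro q ⟨hq, hqθ⟩
  exact ⟨hq.trans (hjJ τ hτ), hqθ ▸ hFm τ q⟩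

/-- Guessing one function suffices for the guessing of unbounded sets and a club. -/
theorem exists_guess {R} (hR : ∀ θ < k.ord, IsSuccLimit θ →
    ∀ g : Ordinal.{u} → Ordinal.{u} → Ordinal.{u},
      (∀ i < κ.ord, ∀ δ < (succ κ).ord, δ < g δ i ∧ g δ i < (succ κ).ord) →
        ¬ Misses κ x l z R θ g) (hκ : ℵ₀ ≤ κ) (hkκ : k ≤ κ)
    {A : Ordinal.{u} → Set Ordinal.{u}} (hA : ∀ i < κ.ord, IsUnboundedIn (A i) (succ κ).ord)
    {θ : Ordinal.{u}} (hθ : θ < k.ord) (hθ' : IsSuccLimit θ) {D : Set Ordinal.{u}}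
    (hD : IsClubIn D (succ κ).ord) :
    ∃ β < (succ κ).ord, IsSuccLimit β ∧ l β = z ∧
      otp (adjust R (x β)) = Ordinal.lift.{u + 1} θ ∧
      ∀ i < θ, nth (adjust R (x β)) (i + 1) ∈ A i ∧ ∃ b ∈ D,
        nth (adjust R (x β)) i < b ∧ b < nth (adjust R (x β)) (i + 1) := by
  have hlim : IsSuccLimit (succ κ).ord := isSuccLimit_ord (hκ.trans (le_succ κ))
  -- `g δ i` is an element of `A i` beyond some element of `D` beyond `δ`; guessing it yields (a)
  -- and (b) together.
  have hg : ∀ δ i, ∃ ξ, i < κ.ord → δ < (succ κ).ord → ξ ∈ A i ∧ ∃ b ∈ D, δ < b ∧ b < ξ := by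
    intro δ i
    by_cases h : i < κ.ord ∧ δ < (succ κ).ord
    · obtain ⟨b, hb, hδb⟩ := ((isClubIn_iff hlim).1 hD).2.1 δ h.2
      obtain ⟨ξ, hξ, hbξ⟩ := (hA i h.1).exists_gt hlim (hD.1 hb)
      exact ⟨ξ, fun _ _ => ⟨hξ, b, hb, hδb, hbξ⟩⟩
    · exact ⟨0, fun h1 h2 => absurd ⟨h1, h2⟩ h⟩
  choose g hg using hg
  have := hR θ hθ hθ' g fun i hi δ hδ => by
    obtain ⟨h1, b, -, h2, h3⟩ := hg δ i hi hδ
    exact ⟨h2.trans h3, (hA i hi).1 h1⟩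
  rw [Misses] at this
  push Not at this
  obtain ⟨β, hβ, hβ', hβz, hotp, h⟩ := this
  refine ⟨β, hβ, hβ', hβz, hotp, fun i hi => ?_⟩
  obtain ⟨δ, hδ, hle, heq⟩ := h i hi
  obtain ⟨h1, b, hb, h2, h3⟩ := hg δ i (hi.trans (hθ.trans_le (ord_le_ord.2 hkκ))) hδ
  rw [heq]
  exact ⟨h1, b, hb, hle.trans_lt h2, h3⟩

/-- A labelled square sequence with sufficiently many good points of suitable labels can be adjusted
to a sequence which witnesses the Ostaszewski square. -/
theorem ostaszewski_of_labels (hκ : ℵ₀ ≤ κ) (hpow : κ ^ κ = succ κ) (hx : IsSquareSeq κ x)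
    (hl : ∀ α < (succ κ).ord, IsSuccLimit α → ∀ β ∈ acc (x α), l β = l α)
    (k : L → Cardinal.{u}) (hkκ : ∀ z, k z ≤ κ)
    (hz : ∀ θ < κ.ord, ∃ z, θ < (k z).ord ∧ ∀ h : Ordinal.{u} → Ordinal.{u},
      (∀ δ < (succ κ).ord, h δ < (succ κ).ord) → ∃ α < (succ κ).ord, IsSuccLimit α ∧
        (∀ δ < α, h δ < α) ∧ l α = z ∧ IsGood κ (k z) (x α) α) :
    Ostaszewski κ := by
  have hR : ∀ z, ∃ R, IsStepRel R ∧ ((∀ h : Ordinal.{u} → Ordinal.{u},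
      (∀ δ < (succ κ).ord, h δ < (succ κ).ord) → ∃ α < (succ κ).ord, IsSuccLimit α ∧
        (∀ δ < α, h δ < α) ∧ l α = z ∧ IsGood κ (k z) (x α) α) →
      ∀ θ < (k z).ord, IsSuccLimit θ → ∀ g : Ordinal.{u} → Ordinal.{u} → Ordinal.{u},
        (∀ i < κ.ord, ∀ δ < (succ κ).ord, δ < g δ i ∧ g δ i < (succ κ).ord) →
          ¬ Misses κ x l z R θ g) := by
    intro z
    by_cases h : ∀ h : Ordinal.{u} → Ordinal.{u}, (∀ δ < (succ κ).ord, h δ < (succ κ).ord) →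
        ∃ α < (succ κ).ord, IsSuccLimit α ∧ (∀ δ < α, h δ < α) ∧ l α = z ∧
          IsGood κ (k z) (x α) α
    · obtain ⟨R, h1, h2⟩ := exists_not_misses hκ hpow (hkκ z) hx hl h
      exact ⟨R, h1, fun _ => h2⟩
    -- Clubs with a label that is not rich in good points need no guessing; the empty relation keeps
    -- them coherent.
    · exact ⟨fun _ _ _ _ _ => False, ⟨False.elim, False.elim, fun _ => id, fun _ => Iff.rfl⟩,
        fun h' => absurd h' h⟩
  choose R hR hguess using hR
  refine ⟨fun α => adjust (R (l α)) (x α), fun α hα hα' => ?_, fun A hA θ hθ hθ' D hD => ?_⟩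
  · obtain ⟨h1, h2, h3⟩ := hx α hα hα'
    refine ⟨(hR _).isClubIn_adjust hα' h1, ((hR _).otp_adjust_le h1.1).trans h2, fun β hβ => ?_⟩
    obtain ⟨hβ', h⟩ := (hR _).acc_adjust hα' h1 hβ
    dsimp only
    rw [hl α hα hα' β hβ', h3 β hβ', h]
  · obtain ⟨z, hθz, hz⟩ := hz θ hθ
    obtain ⟨β, hβ, hβ', rfl, h⟩ := exists_guess (hguess z hz) hκ (hkκ z) hA hθz hθ' hD
    exact ⟨β, hβ, hβ', h⟩

/-! ### Closure points of a given cofinality -/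

/-- The supremum of an increasing sequence of length `μ.ord` whose every term exceeds the values of
`h` up to each earlier term. -/
theorem exists_closed_cof_eq (hκ : ℵ₀ ≤ κ) {μ : Cardinal.{u}} (hμ : μ.IsRegular) (hμκ : μ ≤ κ)
    {h : Ordinal.{u} → Ordinal.{u}} (hh : ∀ δ < (succ κ).ord, h δ < (succ κ).ord) :
    ∃ α < (succ κ).ord, IsSuccLimit α ∧ (∀ δ < α, h δ < α) ∧ α.cof = μ := by
  have hμκ' : μ.ord < (succ κ).ord := ord_lt_ord.2 (lt_succ_iff.2 hμκ)
  have hlim : IsSuccLimit (succ κ).ord := isSuccLimit_ord (hκ.trans (le_succ κ))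
  have hH : ∀ d, ∃ m, d < (succ κ).ord → m < (succ κ).ord ∧ ∀ δ < succ d, h δ < m := by
    intro d
    by_cases hd : d < (succ κ).ord
    · obtain ⟨m, h1, h2⟩ := exists_bound (f := h) (card_lt_cof_ord_succ hκ (hlim.succ_lt hd))
        fun δ hδ => hh δ (hδ.trans (hlim.succ_lt hd))
      exact ⟨m, fun _ => ⟨h1, h2⟩⟩
    · exact ⟨0, fun h => absurd h hd⟩
  choose m hm using hH
  obtain ⟨b, hb⟩ := exists_rec (β := Ordinal.{u})
    (fun i b c => i < (succ κ).ord → (∀ j < i, b j < (succ κ).ord) →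
      c < (succ κ).ord ∧ ∀ j < i, b j < c ∧ m (b j) < c)
    (by
      intro i b b' hbb' c hc hi hb'
      have h := hc hi fun j hj => (hbb' j hj).symm ▸ hb' j hj
      exact ⟨h.1, fun j hj => hbb' j hj ▸ h.2 j hj⟩)
    (by
      intro i b
      by_cases hi : i < (succ κ).ord ∧ ∀ j < i, b j < (succ κ).ord
      · obtain ⟨c, hc, h⟩ := exists_bound (f := fun j => max (b j) (m (b j)))
          (card_lt_cof_ord_succ hκ hi.1) fun j hj => max_lt (hi.2 j hj) (hm _ (hi.2 j hj)).1
        exact ⟨c, fun _ _ => ⟨hc, fun j hj => max_lt_iff.1 (h j hj)⟩⟩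
      · exact ⟨0, fun h1 h2 => absurd ⟨h1, h2⟩ hi⟩)
  have hbκ : ∀ i < (succ κ).ord, b i < (succ κ).ord := by
    intro i
    induction i using WellFoundedLT.induction with
    | ind i ih => exact fun hi => (hb i hi fun j hj => ih j hj (hj.trans hi)).1
  have hlt : ∀ i < (succ κ).ord, ∀ j < i, b j < b i ∧ m (b j) < b i := fun i hi =>
    (hb i hi fun j hj => hbκ j (hj.trans hi)).2
  let f : Iio μ.ord → Ordinal.{u} := fun i => b i
  have hf : StrictMono f := fun i j hij => (hlt j (lt_trans j.2 hμκ') i hij).1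
  have hμlim : IsSuccLimit μ.ord := isSuccLimit_ord hμ.aleph0_le
  have hcof : (⨆ i, f i).cof = μ := by
    rw [cof_iSup_Iio hf hμlim.isSuccPrelimit, hμ.cof_ord]
  refine ⟨⨆ i, f i, ?_, ?_, fun δ hδ => ?_, hcof⟩
  · obtain ⟨c, hc, h⟩ := exists_bound (θ := μ.ord) (f := b) (card_lt_cof_ord_succ hκ hμκ')
      fun i hi => hbκ i (hi.trans hμκ')
    exact (ciSup_le' fun i : Iio μ.ord => (h i i.2).le).trans_lt hc
  · rw [← one_lt_cof_iff, hcof]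
    exact one_lt_aleph0.trans_le hμ.aleph0_le
  · obtain ⟨⟨i, hi⟩, hδi⟩ := exists_lt_of_lt_ciSup' hδ
    have hi' := hμlim.succ_lt hi
    calc h δ < m (b i) := (hm _ (hbκ i (lt_trans hi hμκ'))).2 δ (lt_succ_iff.2 hδi.le)
      _ < b (succ i) := (hlt _ (hi'.trans hμκ') i (lt_succ i)).2
      _ ≤ ⨆ i, f i := le_ciSup (f := f) bddAbove_of_small ⟨succ i, hi'⟩

/-- Both sides are the cofinality of the club, which is cofinal in `α`. -/
theorem cof_otp {y : Set Ordinal.{u}} {α : Ordinal.{u}} (hy : IsClubIn y α) :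
    (otp y).cof = Cardinal.lift.{u + 1} α.cof := by
  have e : ((fun γ : Iio α => (γ : Ordinal.{u})) ⁻¹' y : Set (Iio α)) ≃o y :=
    ⟨⟨fun a => ⟨a.1.1, a.2⟩, fun a => ⟨⟨a, hy.1 a.2⟩, a.2⟩, fun _ => rfl, fun _ => rfl⟩, Iff.rfl⟩
  rw [otp, cof_type, ← e.cof_congr, Order.cof_eq_of_isCofinal hy.2.isCofinal, Ordinal.cof_Iio, lift_cof]

/-! ### Regular cardinals -/

/-- One label suffices. At points of cofinality `κ` the club has order type exactly `κ`, so every `v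
δ` is below some position and `τ = 0` will do. -/
theorem ostaszewski_of_isRegular (hκ : κ.IsRegular) (hpow : κ ^ κ = succ κ)
    (hx : IsSquareSeq κ x) : Ostaszewski κ := by
  have hκ0 := hκ.aleph0_le
  refine ostaszewski_of_labels (L := Unit) (l := fun _ => ()) hκ0 hpow hx
    (fun _ _ _ _ _ => rfl) (fun _ => κ) (fun _ => le_rfl) fun θ hθ => ⟨(), hθ, fun h hh => ?_⟩
  obtain ⟨α, hακ, hα, hcl, hcof⟩ := exists_closed_cof_eq hκ0 hκ le_rfl hh
  obtain ⟨h1, h2, -⟩ := hx α hακ hα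
  have hotp : otp (x α) = Ordinal.lift.{u + 1} κ.ord := by
    refine le_antisymm h2 ?_
    rw [lift_ord, ← hcof, ← cof_otp h1]
    exact ord_cof_le _
  have hlim : IsSuccLimit κ.ord := isSuccLimit_ord hκ0
  refine ⟨α, hακ, hα, hcl, rfl, hcof.ge, fun v hv => ⟨0, hlim.bot_lt, fun b hb => ?_⟩⟩
  obtain ⟨δ, hδ, hbδ⟩ := ((isClubIn_iff hα).1 h1).2.1 b hb
  obtain ⟨γ, hγ, h⟩ := exists_otp_inter_eq (x := x α) (o := Ordinal.lift.{u + 1} (succ (v δ)))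
    (by rw [hotp, Ordinal.lift_lt]; exact hlim.succ_lt (hv δ (h1.1 hδ)))
  refine ⟨δ, hδ, hbδ.le, γ, hγ, Or.inr ?_⟩
  rw [h, Ordinal.lift_lt]
  exact lt_succ _

/-! ### Cutting off initial parts of the clubs -/

section cut

variable (Z : Set Ordinal.{u + 1}) (y : Set Ordinal.{u})

/-- The part of `y` after all positions that are members of `Z`. -/
def tailPart : Set Ordinal.{u} :=
  {γ | γ ∈ y ∧ ∀ s ∈ Z, s < otp y → s ≤ otp (y ∩ Iio γ)}

open Classical in
/-- Cut off an initial part of `y`, or else take the elements of `y` with positions in `Z`. -/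
noncomputable def cut : Set Ordinal.{u} :=
  if (tailPart Z y).Nonempty then tailPart Z y else {γ | γ ∈ y ∧ otp (y ∩ Iio γ) ∈ Z}

open Classical in
/-- The label of `y`: the set of positions in `Z`, if an initial part of `y` is cut off. -/
noncomputable def cutLabel : Option (Set Ordinal.{u + 1}) :=
  if (tailPart Z y).Nonempty then some {s | s ∈ Z ∧ s < otp y} else none

variable {Z y} {α β : Ordinal.{u}}

theorem cut_subset : cut Z y ⊆ y := by
  rw [cut]
  split_ifs
  · exact fun γ hγ => hγ.1
  · exact fun γ hγ => hγ.1

theorem otp_inter_mono {γ δ : Ordinal.{u}} (h : γ ≤ δ) : otp (y ∩ Iio γ) ≤ otp (y ∩ Iio δ) :=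
  otp_mono (inter_subset_inter_right y (Iio_subset_Iio h))

/-- If the tail is empty, the positions in `Z` are cofinal in the order type of `y`; the closure
assumption on `Z` then makes the selected elements closed. -/
theorem isClubIn_cut (hα : IsSuccLimit α) (hy : IsClubIn y α)
    (hZ : ∀ o < otp y, o ≠ 0 → (∀ a < o, ∃ s ∈ Z, a < s ∧ s < o) → o ∈ Z) :
    IsClubIn (cut Z y) α := by
  obtain ⟨hyα, hub, hcl⟩ := (isClubIn_iff hα).1 hy
  rw [isClubIn_iff hα]
  refine ⟨cut_subset.trans hyα, ?_⟩
  rw [cut]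
  split_ifs with hne
  · refine ⟨fun b hb => ?_, fun γ hγ hl => ⟨hcl γ hγ (hl.mono fun _ h => h.1), fun s hs hsy => ?_⟩⟩
    · obtain ⟨c, hc, hc'⟩ := hne
      obtain ⟨d, hd, hlt⟩ := hub _ (max_lt hb (hyα hc))
      exact ⟨d, ⟨hd, fun s hs hsy => (hc' s hs hsy).trans
        (otp_inter_mono ((le_max_right _ _).trans hlt.le))⟩, (le_max_left _ _).trans_lt hlt⟩
    · obtain ⟨c, hc, -, hcγ⟩ := hl.2 0 (pos_iff_ne_zero.2 hl.1)
      exact (hc.2 s hs hsy).trans (otp_inter_mono hcγ.le)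
  · refine ⟨fun b hb => ?_, fun γ hγ hl => ?_⟩
    · obtain ⟨c, hc, hbc⟩ := hub b hb
      have : ¬ ∀ s ∈ Z, s < otp y → s ≤ otp (y ∩ Iio c) := fun h => hne ⟨c, hc, h⟩
      push Not at this
      obtain ⟨s, hs, hsy, hlt⟩ := this
      obtain ⟨d, hd, rfl⟩ := exists_otp_inter_eq hsy
      exact ⟨d, ⟨hd, hs⟩, hbc.trans (lt_of_otp_inter_lt hlt)⟩
    · have hγy := hcl γ hγ (hl.mono fun _ h => h.1)
      refine ⟨hγy, hZ _ (otp_inter_lt hγy) ?_ fun a ha => ?_⟩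
      · obtain ⟨c, hc, -, hcγ⟩ := hl.2 0 (pos_iff_ne_zero.2 hl.1)
        exact (bot_le.trans_lt (otp_inter_lt_otp_inter hc.1 hcγ)).ne'
      · obtain ⟨d, hd, hdγ, rfl⟩ := exists_lt_otp_inter ha
        obtain ⟨c, hc, hdc, hcγ⟩ := hl.2 d hdγ
        exact ⟨_, hc.2, otp_inter_lt_otp_inter hd hdc, otp_inter_lt_otp_inter hc.1 hcγ⟩

/-- Whether a tail exists is inherited by `y ∩ Iio β`: in the first case all positions in `Z` are
already passed below `β`, in the second they are cofinal below `β`. So both the cut and the label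
cohere. -/
theorem acc_cut (hβ : β ∈ acc (cut Z y)) :
    β ∈ acc y ∧ cut Z (y ∩ Iio β) = cut Z y ∩ Iio β ∧
      cutLabel Z (y ∩ Iio β) = cutLabel Z y := by
  obtain ⟨hβ, hl⟩ := mem_acc_iff.1 hβ
  have hβy := cut_subset hβ
  refine ⟨mem_acc_iff.2 ⟨hβy, hl.mono cut_subset⟩, ?_⟩
  have hinter : ∀ γ < β, y ∩ Iio β ∩ Iio γ = y ∩ Iio γ := fun γ hγ => by
    rw [inter_assoc, Iio_inter_Iio, min_eq_right hγ.le]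
  obtain ⟨c, hc, -, hcβ⟩ := hl.2 0 (pos_iff_ne_zero.2 hl.1)
  have hlt := otp_inter_lt hβy
  by_cases hne : (tailPart Z y).Nonempty
  · have hcut : cut Z y = tailPart Z y := if_pos hne
    rw [hcut] at hβ hl hc ⊢
    have hZ : ∀ s ∈ Z, s < otp y → s < otp (y ∩ Iio β) := fun s hs hsy =>
      (hc.2 s hs hsy).trans_lt (otp_inter_lt_otp_inter hc.1 hcβ)
    have htail : tailPart Z (y ∩ Iio β) = tailPart Z y ∩ Iio β := by
      ext γ
      constructor
      · rintro ⟨⟨hγ, hγβ⟩, h⟩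
        refine ⟨⟨hγ, fun s hs hsy => ?_⟩, hγβ⟩
        rw [← hinter γ hγβ]
        exact h s hs (hZ s hs hsy)
      · rintro ⟨⟨hγ, h⟩, hγβ⟩
        refine ⟨⟨hγ, hγβ⟩, fun s hs hsy => ?_⟩
        rw [hinter γ hγβ]
        exact h s hs (hsy.trans hlt)
    have hne' : (tailPart Z (y ∩ Iio β)).Nonempty := htail ▸ ⟨c, hc, hcβ⟩
    rw [cut, if_pos hne', cutLabel, if_pos hne', cutLabel, if_pos hne, htail]
    refine ⟨rfl, congrArg some ?_⟩
    ext s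
    exact ⟨fun h => ⟨h.1, h.2.trans hlt⟩, fun h => ⟨h.1, hZ s h.1 h.2⟩⟩
  · have hcut : cut Z y = {γ | γ ∈ y ∧ otp (y ∩ Iio γ) ∈ Z} := if_neg hne
    rw [hcut] at hβ hl hc ⊢
    have hne' : ¬ (tailPart Z (y ∩ Iio β)).Nonempty := by
      rintro ⟨γ, ⟨hγ, hγβ⟩, h⟩
      obtain ⟨d, hd, hγd, hdβ⟩ := hl.2 γ hγβ
      have := h _ hd.2 (otp_inter_lt_otp_inter hd.1 hdβ)
      rw [hinter γ hγβ] at this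
      exact absurd (otp_inter_lt_otp_inter hγ hγd) (not_lt.2 this)
    rw [cut, if_neg hne', cutLabel, if_neg hne', cutLabel, if_neg hne]
    refine ⟨?_, rfl⟩
    ext γ
    constructor
    · rintro ⟨⟨hγ, hγβ⟩, h⟩
      exact ⟨⟨hγ, hinter γ hγβ ▸ h⟩, hγβ⟩
    · rintro ⟨⟨hγ, h⟩, hγβ⟩
      exact ⟨⟨hγ, hγβ⟩, (hinter γ hγβ).symm ▸ h⟩

end cut

/-! ### Singular cardinals -/

/-- The points `α` whose clubs have order type `σ` meet every club in `κ⁺`. -/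
def IsStationaryType (κ : Cardinal.{u}) (x : Ordinal.{u} → Set Ordinal.{u}) (σ : Ordinal.{u}) :
    Prop :=
  ∀ h : Ordinal.{u} → Ordinal.{u}, (∀ δ < (succ κ).ord, h δ < (succ κ).ord) →
    ∃ α < (succ κ).ord, IsSuccLimit α ∧ (∀ δ < α, h δ < α) ∧
      otp (x α) = Ordinal.lift.{u + 1} σ

theorem cof_eq_of_otp_eq (hx : IsSquareSeq κ x) {α σ : Ordinal.{u}} (hα : α < (succ κ).ord)
    (hα' : IsSuccLimit α) (h : otp (x α) = Ordinal.lift.{u + 1} σ) : σ.cof = α.cof := by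
  have := cof_otp (hx α hα hα').1
  rwa [h, ← lift_cof, Cardinal.lift_inj] at this

/-- Otherwise the closure functions refuting the various `σ < κ` have a common bound. A closure
point of cofinality `μ` for it has a club of some type `σ ≤ κ` with cofinality `μ`; this `σ` is not
`κ`, so it was refuted. -/
theorem exists_isStationaryType (hκ : ℵ₀ ≤ κ) (hx : IsSquareSeq κ x) {μ : Cardinal.{u}}
    (hμ : μ.IsRegular) (hμκ : μ ≤ κ) (hcof : μ ≠ κ.ord.cof) :
    ∃ σ < κ.ord, σ.cof = μ ∧ IsStationaryType κ x σ := by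
  by_contra! hcon
  have : ∀ σ, ∃ h : Ordinal.{u} → Ordinal.{u}, σ < κ.ord → σ.cof = μ →
      (∀ δ < (succ κ).ord, h δ < (succ κ).ord) ∧
      ∀ α < (succ κ).ord, IsSuccLimit α → (∀ δ < α, h δ < α) →
        otp (x α) ≠ Ordinal.lift.{u + 1} σ := by
    intro σ
    by_cases hσ : σ < κ.ord ∧ σ.cof = μ
    · have := hcon σ hσ.1 hσ.2
      rw [IsStationaryType] at this
      push Not at this
      obtain ⟨h, h1, h2⟩ := this
      exact ⟨h, fun _ _ => ⟨h1, h2⟩⟩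
    · exact ⟨id, fun h1 h2 => absurd ⟨h1, h2⟩ hσ⟩
  choose h hh using this
  have hm : ∀ δ, ∃ m, δ < (succ κ).ord → m < (succ κ).ord ∧
      ∀ σ < κ.ord, σ.cof = μ → h σ δ < m := by
    intro δ
    by_cases hδ : δ < (succ κ).ord
    · obtain ⟨m, h1, h2⟩ := exists_bound (θ := κ.ord) (α := (succ κ).ord)
        (f := fun σ => if σ.cof = μ then h σ δ else 0)
        (card_lt_cof_ord_succ hκ (ord_lt_ord_succ κ)) fun σ hσ => by
          split_ifs with hσμ
          · exact (hh σ hσ hσμ).1 δ hδ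
          · exact bot_le.trans_lt hδ
      exact ⟨m, fun _ => ⟨h1, fun σ hσ hσμ => by simpa [hσμ] using h2 σ hσ⟩⟩
    · exact ⟨0, fun h => absurd h hδ⟩
  choose m hm using hm
  obtain ⟨α, hακ, hα, hcl, hαμ⟩ := exists_closed_cof_eq hκ hμ hμκ fun δ hδ => (hm δ hδ).1
  obtain ⟨σ, hσ, hσα⟩ := Ordinal.le_lift_iff.1 (hx α hακ hα).2.1
  have hσμ : σ.cof = μ := (cof_eq_of_otp_eq hx hακ hα hσα.symm).trans hαμ
  have hσκ : σ < κ.ord := lt_of_le_of_ne hσ fun h => hcof (h ▸ hσμ.symm)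
  exact (hh σ hσκ hσμ).2 α hακ hα
    (fun δ hδ => ((hm δ (hδ.trans hακ)).2 σ hσκ hσμ).trans (hcl δ hδ)) hσα.symm

/-- A cofinal map from the cofinality. -/
theorem exists_cofinal_map (κ : Cardinal.{u}) :
    ∃ f : Ordinal.{u} → Ordinal.{u}, (∀ j < κ.ord.cof.ord, f j < κ.ord) ∧
      ∀ b < κ.ord, ∃ j < κ.ord.cof.ord, b ≤ f j := by
  obtain ⟨S, hS, hcard⟩ := Order.exists_cof_eq (Iio κ.ord)
  have : #(Iio κ.ord.cof.ord) = #S := by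
    rw [hcard, Ordinal.cof_Iio, Cardinal.mk_Iio_ordinal, card_ord, lift_cof]
  obtain ⟨e⟩ := Cardinal.eq.1 this
  refine ⟨fun j => if h : j < κ.ord.cof.ord then (e ⟨j, h⟩ : Iio κ.ord) else 0, fun j hj => ?_,
    fun b hb => ?_⟩
  · simp only [dif_pos hj]
    exact (e ⟨j, hj⟩ : Iio κ.ord).2
  · obtain ⟨c, hc, hbc⟩ := hS ⟨b, hb⟩
    refine ⟨e.symm ⟨c, hc⟩, (e.symm ⟨c, hc⟩).2, ?_⟩
    dsimp only
    rw [dif_pos (mem_Iio.1 (e.symm ⟨c, hc⟩).2)]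
    exact (Subtype.coe_le_coe.2 hbc).trans_eq (congrArg (fun a : S => ((a : Iio κ.ord) : Ordinal))
      (e.apply_symm_apply ⟨c, hc⟩).symm)

/-- A continuous cofinal sequence `s` in a singular cardinal, with stationary types `t i` of large
cofinality between `s i` and `s (i + 1)`. -/
theorem exists_blocks (hκ : κ.IsSingular) (hx : IsSquareSeq κ x) :
    ∃ s t : Ordinal.{u} → Ordinal.{u},
      (∀ i < κ.ord.cof.ord, s i < κ.ord ∧ t i < κ.ord ∧ (s i).card < (t i).cof ∧
        κ.ord.cof < (t i).cof ∧ IsStationaryType κ x (t i)) ∧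
      (∀ i, ∀ j < i, t j < s i) ∧ (∀ b < κ.ord, ∃ j < κ.ord.cof.ord, b < s j) ∧
      ∀ i o, IsSuccLimit i → (∀ j < i, s j ≤ o) → s i ≤ o := by
  have hκ0 : ℵ₀ ≤ κ := hκ.aleph0_le
  have hlim : IsSuccLimit κ.ord := isSuccLimit_ord hκ0
  have hcof0 : ℵ₀ ≤ κ.ord.cof := (isRegular_cof hlim).aleph0_le
  have hF : ∀ b, ∃ t, b < κ.ord → t < κ.ord ∧ b.card < t.cof ∧ κ.ord.cof < t.cof ∧
      IsStationaryType κ x t := by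
    intro b
    by_cases hb : b < κ.ord
    -- The successor is a regular cardinal above both requirements and stays below `κ`, as a
    -- singular cardinal is a limit cardinal.
    · have hμ := isRegular_succ (hcof0.trans (le_max_right b.card κ.ord.cof))
      have hlt : succ (max b.card κ.ord.cof) < κ :=
        hκ.isSuccLimit.succ_lt (max_lt (lt_ord.1 hb) hκ.cof_ord_lt)
      have hcof : κ.ord.cof < succ (max b.card κ.ord.cof) := lt_succ_iff.2 (le_max_right _ _)
      obtain ⟨σ, h1, h2, h3⟩ := exists_isStationaryType hκ0 hx hμ hlt.le hcof.ne'
      exact ⟨σ, fun _ => ⟨h1, h2 ▸ lt_succ_iff.2 (le_max_left _ _), h2 ▸ hcof, h3⟩⟩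
    · exact ⟨0, fun h => absurd h hb⟩
  choose F hF using hF
  obtain ⟨f, hf, hfcof⟩ := exists_cofinal_map κ
  obtain ⟨s, hs⟩ := exists_rec (β := Ordinal.{u})
    (fun i s c => c = sSup ((fun j => succ (max (F (s j)) (f j))) '' Iio i))
    (by
      intro i s s' hss' c hc
      rw [hc]
      congr 1
      exact image_congr fun j hj => by rw [hss' j hj])
    (fun i s => ⟨_, rfl⟩)
  have hle : ∀ i, ∀ j < i, succ (max (F (s j)) (f j)) ≤ s i := fun i j hj => by
    rw [hs i]
    exact le_csSup bddAbove_of_small ⟨j, hj, rfl⟩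
  have hsκ : ∀ i < κ.ord.cof.ord, s i < κ.ord := by
    intro i
    induction i using WellFoundedLT.induction with
    | ind i ih =>
      intro hi
      rw [hs i]
      refine sSup_lt_of_lt_cof ?_ ?_
      · refine mk_image_le.trans_lt ?_
        rw [Cardinal.mk_Iio_ordinal, ← lift_cof, Cardinal.lift_lt]
        exact lt_ord.1 hi
      · rintro _ ⟨j, hj, rfl⟩
        have hj' := lt_trans hj hi
        exact hlim.succ_lt (max_lt (hF _ (ih j hj hj')).1 (hf j hj'))
  have hcoflim : IsSuccLimit κ.ord.cof.ord := isSuccLimit_ord hcof0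
  refine ⟨s, fun i => F (s i), fun i hi => ⟨hsκ i hi, hF _ (hsκ i hi)⟩,
    fun i j hj => (le_max_left _ _).trans_lt (succ_le_iff.1 (hle i j hj)), fun b hb => ?_,
    fun i o hi ho => ?_⟩
  · obtain ⟨j, hj, hbj⟩ := hfcof b hb
    exact ⟨succ j, hcoflim.succ_lt hj, hbj.trans_lt ((le_max_right _ _).trans_lt
      (succ_le_iff.1 (hle _ j (lt_succ j))))⟩
  · rw [hs i]
    refine csSup_le' ?_
    rintro _ ⟨j, hj, rfl⟩
    exact (hle _ j (lt_succ j)).trans (ho _ (hi.succ_lt hj))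

/-- The clubs are cut along the positions `s i`. A club of type `t i` passes exactly the positions
`s j` with `j ≤ i`, so its label determines `i`, and this label takes care of the `θ` below the
cofinality of `t i`. -/
theorem ostaszewski_of_isSingular (hκ : κ.IsSingular) (hpow : κ ^ κ = succ κ)
    (hx : IsSquareSeq κ x) : Ostaszewski κ := by
  have hκ0 : ℵ₀ ≤ κ := hκ.aleph0_le
  have hlim : IsSuccLimit κ.ord := isSuccLimit_ord hκ0
  have hcoflim : IsSuccLimit κ.ord.cof.ord := isSuccLimit_ord (isRegular_cof hlim).aleph0_le
  obtain ⟨s, t, hst, hts, hscof, hscont⟩ := exists_blocks hκ hx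
  have hst' : ∀ i < κ.ord.cof.ord, s i < t i := fun i hi =>
    lt_of_not_ge fun h => absurd ((cof_le_card _).trans (Ordinal.card_le_card h))
      (not_le.2 (hst i hi).2.2.1)
  have hmono : ∀ i < κ.ord.cof.ord, ∀ j < i, s j < s i := fun i hi j hj =>
    (hst' j (hj.trans hi)).trans (hts i j hj)
  have hindex : ∀ i < κ.ord.cof.ord, ∀ j < κ.ord.cof.ord, s j < t i → j ≤ i := fun i _ j hj h =>
    not_lt.1 fun hij => absurd (h.trans (hts j i hij)) (lt_irrefl _)
  set Z : Set Ordinal.{u + 1} := {a | ∃ i < κ.ord.cof.ord, Ordinal.lift.{u + 1} (s i) = a} with hZ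
  have hclosed : ∀ o < Ordinal.lift.{u + 1} κ.ord, o ≠ 0 →
      (∀ a < o, ∃ r ∈ Z, a < r ∧ r < o) → o ∈ Z := by
    intro o ho ho0 h
    obtain ⟨o, hoκ, rfl⟩ := Ordinal.lt_lift_iff.1 ho
    have h' : ∀ a < o, ∃ i < κ.ord.cof.ord, a < s i ∧ s i < o := fun a ha => by
      obtain ⟨_, ⟨i, hi, rfl⟩, h1, h2⟩ := h _ (Ordinal.lift_lt.2 ha)
      exact ⟨i, hi, Ordinal.lift_lt.1 h1, Ordinal.lift_lt.1 h2⟩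
    obtain ⟨j, hj, hoj⟩ := hscof o hoκ
    have hne : {i | i < κ.ord.cof.ord ∧ o ≤ s i}.Nonempty := ⟨j, hj, hoj.le⟩
    set i := sInf {i | i < κ.ord.cof.ord ∧ o ≤ s i}
    obtain ⟨hi, hoi⟩ : i < κ.ord.cof.ord ∧ o ≤ s i := csInf_mem hne
    have hlt : ∀ j < i, s j < o := fun j hj => by
      by_contra hge
      exact notMem_of_lt_csInf hj (OrderBot.bddBelow _) ⟨hj.trans hi, not_lt.1 hge⟩
    have hsucc : ∀ a < o, ∃ j < i, a < s j := fun a ha => by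
      obtain ⟨j, hj, h1, h2⟩ := h' a ha
      refine ⟨j, not_le.1 fun hij => ?_, h1⟩
      rcases hij.eq_or_lt with rfl | hij
      · exact absurd hoi (not_le.2 h2)
      · exact absurd (hoi.trans (hmono j hj i hij).le) (not_le.2 h2)
    -- The first `s i` reaching a limit `o` of the sequence has limit index, and continuity of `s`
    -- gives `s i = o`.
    have hil : IsSuccLimit i := by
      refine Ordinal.isSuccLimit_iff.2 ⟨?_, isSuccPrelimit_iff_succ_lt.2 fun k hk => ?_⟩
      · rintro hi0
        obtain ⟨j, hj, -⟩ := hsucc 0 (pos_iff_ne_zero.2 fun h0 => ho0 (by rw [h0, Ordinal.lift_zero]))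
        rw [hi0] at hj
        exact not_lt_bot hj
      · obtain ⟨j, hj, h⟩ := hsucc _ (hlt k hk)
        refine (succ_le_of_lt (not_le.1 fun hjk => ?_)).trans_lt hj
        rcases hjk.eq_or_lt with rfl | hjk
        · exact lt_irrefl _ h
        · exact lt_asymm h (hmono k (hk.trans hi) j hjk)
    exact ⟨i, hi, by rw [le_antisymm (hscont i o hil fun j hj => (hlt j hj).le) hoi]⟩
  have hcut : IsSquareSeq κ fun α => cut Z (x α) := by
    intro α hακ hα
    obtain ⟨h1, h2, h3⟩ := hx α hακ hα
    refine ⟨isClubIn_cut hα h1 fun o ho => hclosed o (ho.trans_le h2),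
      (otp_mono cut_subset).trans h2, fun β hβ => ?_⟩
    obtain ⟨h4, h5, -⟩ := acc_cut hβ
    dsimp only
    rw [h3 β h4, h5]
  let z : Ordinal.{u} → Option (Set Ordinal.{u + 1}) :=
    fun i => some {r | r ∈ Z ∧ r < Ordinal.lift.{u + 1} (t i)}
  have hzinj : ∀ i < κ.ord.cof.ord, ∀ j < κ.ord.cof.ord, z i = z j → j ≤ i := by
    intro i hi j hj h
    have hmem : Ordinal.lift.{u + 1} (s j) ∈ {r | r ∈ Z ∧ r < Ordinal.lift.{u + 1} (t j)} :=
      ⟨⟨j, hj, rfl⟩, Ordinal.lift_lt.2 (hst' j hj)⟩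
    rw [← Option.some.inj h] at hmem
    exact hindex i hi j hj (Ordinal.lift_lt.1 hmem.2)
  -- The cofinality of `t i` as a function of the label alone, possible since `z` is injective on
  -- the indices; other labels get `0`.
  have hk : ∀ w, ∃ k : Cardinal.{u}, k ≤ κ ∧ ∀ i < κ.ord.cof.ord, z i = w → k = (t i).cof := by
    intro w
    by_cases hw : ∃ i < κ.ord.cof.ord, z i = w
    · obtain ⟨i, hi, rfl⟩ := hw
      refine ⟨(t i).cof, ?_, fun j hj hij => ?_⟩
      · exact (cof_le_card _).trans (lt_ord.1 (hst i hi).2.1).le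
      · rw [le_antisymm (hzinj j hj i hi hij) (hzinj i hi j hj hij.symm)]
    · exact ⟨0, zero_le, fun i hi h => absurd ⟨i, hi, h⟩ hw⟩
  choose k hkκ hk using hk
  refine ostaszewski_of_labels (l := fun α => cutLabel Z (x α)) hκ0 hpow hcut ?_ k hkκ ?_
  · intro α hακ hα β hβ
    obtain ⟨h1, -, h2⟩ := acc_cut hβ
    rw [(hx α hακ hα).2.2 β h1, h2]
  intro θ hθ
  obtain ⟨i, hi, hθi⟩ := hscof θ hθ
  obtain ⟨hsi, hti, hcard, hcof, hstat⟩ := hst i hi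
  rw [← hk _ i hi rfl] at hcard hcof
  refine ⟨z i, hθi.trans (lt_ord.2 hcard), fun h hh => ?_⟩
  obtain ⟨α, hακ, hα, hcl, hotp⟩ := hstat h hh
  have hαcof : k (z i) = α.cof := (hk _ i hi rfl).trans (cof_eq_of_otp_eq hx hακ hα hotp)
  refine ⟨α, hακ, hα, hcl, ?_, hαcof.le, fun v hv => ?_⟩
  · have hne : (tailPart Z (x α)).Nonempty := by
      obtain ⟨γ, hγ, hγs⟩ := exists_otp_inter_eq (x := x α) (o := Ordinal.lift.{u + 1} (s i))
        (by rw [hotp, Ordinal.lift_lt]; exact hst' i hi)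
      refine ⟨γ, hγ, ?_⟩
      rintro _ ⟨j, hj, rfl⟩ hlt
      rw [hotp, Ordinal.lift_lt] at hlt
      rw [hγs, Ordinal.lift_le]
      rcases (hindex i hi j hj hlt).eq_or_lt with rfl | hji
      · exact le_rfl
      · exact (hmono i hi j hji).le
    rw [cutLabel, if_pos hne, hotp]
  -- If each `s j` failed as `τ`, then `v δ` would be at least `s j` from some `b j < α` on. Since
  -- `cof κ < cof α`, these bounds have a common bound below `α`, beyond which `v δ` would be at
  -- least every `s j`.
  · by_contra! hcon
    obtain ⟨hyα, hub, -⟩ := (isClubIn_iff hα).1 (hcut α hακ hα).1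
    have hb : ∀ j, ∃ b, j < κ.ord.cof.ord → b < α ∧ ∀ δ ∈ cut Z (x α), b ≤ δ → s j ≤ v δ := by
      intro j
      by_cases hj : j < κ.ord.cof.ord
      · obtain ⟨b, hb, h⟩ := hcon (s j) (hst j hj).1
        exact ⟨b, fun _ => ⟨hb, fun δ hδ hbδ => (h δ hδ hbδ δ hδ).1⟩⟩
      · exact ⟨0, fun h => absurd h hj⟩
    choose b hb using hb
    obtain ⟨c, hc, hbc⟩ := exists_bound (θ := κ.ord.cof.ord) (α := α) (f := b)
      (by rw [card_ord, ← hαcof]; exact hcof) fun j hj => (hb j hj).1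
    obtain ⟨δ, hδ, hcδ⟩ := hub c hc
    obtain ⟨j, hj, hlt⟩ := hscof _ (hv δ (hyα hδ))
    exact absurd ((hb j hj).2 δ hδ ((hbc j hj).trans hcδ).le) (not_le.2 hlt)

/-! ### Assembling the regular and the singular case. -/

theorem ostaszewski_of_square (hκ : ℵ₀ ≤ κ) (hpow : κ ^ κ = succ κ) (h : Square κ) :
    Ostaszewski κ := by
  obtain ⟨x, hx⟩ := h
  rcases isRegular_or_isSingular hκ with h | h
  · exact ostaszewski_of_isRegular h hpow hx
  · exact ostaszewski_of_isSingular h hpow hx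

end OstaszewskiSquare

theorem theoremB :
    (∀ κ : Cardinal.{u}, ℵ₀ < κ → IsSuccLimit κ → κ ^ κ = succ κ →
      OstaszewskiSquare.Square κ → OstaszewskiSquare.Ostaszewski κ) ∧
    (∀ κ : Cardinal.{u}, ℵ₀ < κ → (∃ μ : Cardinal.{u}, κ = succ μ) →
      κ ^< κ < κ ^ κ → κ ^ κ = succ κ →
      OstaszewskiSquare.Square κ → OstaszewskiSquare.Ostaszewski κ) ∧
    ((∀ μ : Cardinal.{u}, ℵ₀ ≤ μ → (2 : Cardinal.{u}) ^ μ = succ μ) →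
      ∀ κ : Cardinal.{u}, ℵ₀ < κ →
        (OstaszewskiSquare.Square κ ↔ OstaszewskiSquare.Ostaszewski κ)) := by
  refine ⟨fun κ hκ _ hpow => OstaszewskiSquare.ostaszewski_of_square hκ.le hpow,
    fun κ hκ _ _ hpow => OstaszewskiSquare.ostaszewski_of_square hκ.le hpow,
    fun hGCH κ hκ => ⟨?_, fun ⟨C, hC, _⟩ => ⟨C, hC⟩⟩⟩
  exact OstaszewskiSquare.ostaszewski_of_square hκ.le
    ((power_self_eq hκ.le).trans (hGCH κ hκ.le))
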